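/- Let $-A$ be the generator of a bounded $C_0$-semigroup $(e^{-tA})_{t\ge 0}$ on a complex Banach space $X$, and let $M:=\sup_{t\ge 0}\|e^{-tA}\|$. Let $g\in C^\infty(0,\infty)$ be a bounded completely monotone function, that is, $(-1)^k g^{(k)}\ge 0$ on $(0,\infty)$ for all $k\ge 0$, with $g(0)=1$ and $g'(0)=-1$, where $g^{(k)}(0):=\lim_{z\to 0+}g^{(k)}(z)$; here $g''(0)=\infty$ is allowed. Let $\nu$ be the (unique) positive Borel measure on $[0,\infty)$ with $g(z)=\int_0^\infty e^{-zs}\,\nu(ds)$ for all $z>0$, and put $$L[g]:=\int_{[0,1]}(1-s)\,\nu(ds),\qquad \Delta_0^g(z):=g(z)-e^{-z}.$$ If $f(z)=\int_0^\infty e^{-zs}\mu(ds)$ for a bounded complex Borel measure $\mu$ on $[0,\infty)$, then $f(A)x:=\int_0^\infty e^{-sA}x\,\mu(ds)$ (Hille--Phillips calculus), and $f(rA)$, $r>0$, is defined in the same way from the semigroup $(e^{-srA})_{s\ge0}$. The fractional power $A^\alpha$ is $f(A)$ for $f(z)=z^\alpha$ in the extended Hille--Phillips calculus: $f(A)=e(A)^{-1}(ef)(A)$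 with domain $\{x: (ef)(A)x\in \operatorname{ran} e(A)\}$, where $e$ and $ef$ are Laplace transforms of bounded complex Borel measures on $[0,\infty)$ and $e(A)$ is injective (the result does not depend on $e$). Then the following estimates hold. (1) $\|\Delta_0^g(A)x\|\le 2M\,L[g]\,\|Ax\|$ for all $x\in\operatorname{dom}(A)$, and for every $\alpha\in(0,1)$, $$\|\Delta_0^g(A)x\|\le 8M\,(L[g])^\alpha\,\|A^\alpha x\|,\qquad x\in\operatorname{dom}(A^\alpha).$$ (2) For all integers $n\ge 1$, all $t>0$ and all $x\in\operatorname{dom}(A)$, $$\|g^n(tA/n)x-e^{-tA}x\|\le 4eM\left(1+\frac1{|g'(1/n)|}\right)\sqrt{1+g'(1/n)}\;t\,\|Ax\|,$$ and, for every $\alpha\in(0,1)$, all integers $n\ge1$, all $t>0$ and all $x\in\operatorname{dom}(A^\alpha)$, $$\|g^n(tA/n)x-e^{-tA}x\|\le 16eM\left(1+\frac1{|g'(1/n)|}\right)\bigl(1+g'(1/n)\bigr)^{\alpha/2}\;t^\alpha\,\|A^\alpha x\|.$$ -/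

import Mathlib

open Filter Topology Set MeasureTheory
open scoped NNReal ENNReal ContDiff

noncomputable section

/-! ### Completely monotone functions -/

/-- `g` is completely monotone on `(0, ∞)` (only the values at positive arguments matter). -/
def IsCompletelyMonotone (g : ℝ → ℝ) : Prop :=
  ContDiffOn ℝ ∞ g (Ioi 0) ∧ ∀ (k : ℕ) (z : ℝ), 0 < z → 0 ≤ (-1 : ℝ) ^ k * iteratedDeriv k g z

/-- The class `𝓑₁`: bounded completely monotone functions with `g(0) = 1`, `g'(0) = -1`, where
`g(0)` and `g'(0)` are the limits at `0+`. Nothing is assumed about `g''(0)`. -/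
structure IsB1 (g : ℝ → ℝ) : Prop where
  completelyMonotone : IsCompletelyMonotone g
  bounded : ∃ C : ℝ, ∀ z : ℝ, 0 < z → g z ≤ C
  value_zero : Tendsto g (𝓝[>] 0) (𝓝 1)
  deriv_zero : Tendsto (deriv g) (𝓝[>] 0) (𝓝 (-1))

/-- `g ∼ ν`: the positive Borel measure `ν` on `[0, ∞)` is Laplace transformable with
`g(z) = ∫ e^{-zs} ν(ds)` for all `z > 0`. -/
def IsRepresentedBy (g : ℝ → ℝ) (ν : Measure ℝ≥0) : Prop :=
  ∀ z : ℝ, 0 < z → Integrable (fun s : ℝ≥0 => Real.exp (-(z * s))) ν ∧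
    g z = ∫ s : ℝ≥0, Real.exp (-(z * s)) ∂ν

open Classical in
/-- The (unique) measure `ν` with `g ∼ ν`; it exists for every completely monotone `g`. -/
def bernsteinMeasure (g : ℝ → ℝ) : Measure ℝ≥0 :=
  if h : ∃ ν : Measure ℝ≥0, IsRepresentedBy g ν then h.choose else 0

/-- The functional `L[g] = ∫_{[0,1]} (1 - s) ν(ds)`, where `g ∼ ν`. -/
def functionalL (g : ℝ → ℝ) : ℝ :=
  ∫ s in Icc (0 : ℝ≥0) 1, (1 - (s : ℝ)) ∂(bernsteinMeasure g)

/-! ### Bounded `C₀`-semigroups and their generators -/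

/-- A bounded `C₀`-semigroup `(e^{-tA})_{t ≥ 0}` on `X`. -/
structure BoundedC0Semigroup (X : Type*) [NormedAddCommGroup X] [NormedSpace ℂ X] where
  toFun : ℝ≥0 → X →L[ℂ] X
  map_zero' : toFun 0 = ContinuousLinearMap.id ℂ X
  map_add' : ∀ s t : ℝ≥0, toFun (s + t) = (toFun s).comp (toFun t)
  continuous' : ∀ x : X, Continuous fun t : ℝ≥0 => toFun t x
  bounded' : ∃ C : ℝ, ∀ t : ℝ≥0, ‖toFun t‖ ≤ C

/-- A bounded complex Borel measure has finite total variation. -/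
theorem ComplexMeasure.isFiniteMeasure_variation {α : Type*} [MeasurableSpace α]
    (μ : ComplexMeasure α) : IsFiniteMeasure μ.variation := by
  have h : μ.variation ≤ μ.re.totalVariation + μ.im.totalVariation := by
    apply VectorMeasure.variation_le_of_forall_enorm_le
    intro E _
    rw [Measure.add_apply]
    refine le_trans ?_ (add_le_add (SignedMeasure.enorm_le_totalVariation _ E)
      (SignedMeasure.enorm_le_totalVariation _ E))
    rw [← ofReal_norm, ← ofReal_norm, ← ofReal_norm,
      ← ENNReal.ofReal_add (norm_nonneg _) (norm_nonneg _)]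
    exact ENNReal.ofReal_le_ofReal (Complex.norm_le_abs_re_add_abs_im (μ E))
  exact isFiniteMeasure_of_le _ h

namespace BoundedC0Semigroup

variable {X : Type*} [NormedAddCommGroup X] [NormedSpace ℂ X]

/-- `M = sup_{t ≥ 0} ‖e^{-tA}‖`. -/
def bound (T : BoundedC0Semigroup X) : ℝ := ⨆ t : ℝ≥0, ‖T.toFun t‖

/-- The rescaled semigroup `t ↦ e^{-t(rA)}`; its negative generator is `rA` if `r > 0`. -/
def scale (T : BoundedC0Semigroup X) (r : ℝ≥0) : BoundedC0Semigroup X where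
  toFun t := T.toFun (r * t)
  map_zero' := by rw [mul_zero, T.map_zero']
  map_add' s t := by rw [mul_add, T.map_add']
  continuous' x := (T.continuous' x).comp (continuous_const.mul continuous_id)
  bounded' := T.bounded'.imp fun _ h t => h (r * t)

/-- The operator `A` for which `-A` is the generator of the semigroup:
`A x = lim_{h → 0+} h⁻¹ (x - e^{-hA} x)`, on the set of all `x` for which the limit exists. -/
def negGenerator (T : BoundedC0Semigroup X) : X →ₗ.[ℂ] X where
  domain :=
    { carrier := {x | ∃ y, Tendsto (fun h : ℝ≥0 => ((h : ℝ) : ℂ)⁻¹ • (x - T.toFun h x))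
        (𝓝[>] 0) (𝓝 y)}
      add_mem' := by
        rintro a b ⟨y, hy⟩ ⟨z, hz⟩
        refine ⟨y + z, (hy.add hz).congr fun h => ?_⟩
        rw [map_add, ← smul_add]; congr 1; abel
      zero_mem' := ⟨0, by simp⟩
      smul_mem' := by
        rintro c x ⟨y, hy⟩
        refine ⟨c • y, (hy.const_smul c).congr fun h => ?_⟩
        rw [map_smul, ← smul_sub, smul_comm] }
  toFun :=
    { toFun := fun x => x.2.choose
      map_add' := fun a b => by
        refine tendsto_nhds_unique (a + b).2.choose_spec
          ((a.2.choose_spec.add b.2.choose_spec).congr fun h => ?_)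
        rw [Submodule.coe_add, map_add, ← smul_add]; congr 1; abel
      map_smul' := fun c x => by
        refine tendsto_nhds_unique (c • x).2.choose_spec
          ((x.2.choose_spec.const_smul c).congr fun h => ?_)
        rw [Submodule.coe_smul, map_smul, ← smul_sub, smul_comm] }

theorem integrable_orbit (T : BoundedC0Semigroup X) (μ : ComplexMeasure ℝ≥0) (x : X) :
    μ.Integrable (fun s : ℝ≥0 => T.toFun s x) := by
  have := ComplexMeasure.isFiniteMeasure_variation μ
  obtain ⟨C, hC⟩ := T.bounded'
  refine Integrable.of_bound (T.continuous' x).aestronglyMeasurable (C * ‖x‖) (ae_of_all _ fun s => ?_)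
  exact (T.toFun s).le_of_opNorm_le (hC s) x

/-! ### The Hille-Phillips functional calculus -/

/-- The bounded operator `x ↦ ∫ e^{-sA} x μ(ds)` for a bounded Borel measure `μ` on `[0, ∞)`. -/
def integralOp [CompleteSpace X] (T : BoundedC0Semigroup X) (μ : ComplexMeasure ℝ≥0) :
    X →L[ℂ] X :=
  LinearMap.mkContinuousOfExistsBound
    { toFun := fun x => μ.integral (fun s => T.toFun s x) (ContinuousLinearMap.lsmul ℝ ℂ).flip
      map_add' := fun x y => by
        simp only [map_add]
        exact VectorMeasure.integral_fun_add (T.integrable_orbit μ x) (T.integrable_orbit μ y)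
      map_smul' := fun c x => by
        simp only [map_smul, RingHom.id_apply, VectorMeasure.integral_eq_setToFun]
        refine setToFun_smul _ (fun c s x => ?_) c _
        exact smul_comm (μ s) c x }
    (by
      have := ComplexMeasure.isFiniteMeasure_variation μ
      obtain ⟨C, hC⟩ := T.bounded'
      refine ⟨C * ‖(ContinuousLinearMap.lsmul ℝ ℂ : ℂ →L[ℝ] X →L[ℝ] X).flip‖
        * μ.variation.real univ, fun x => ?_⟩
      refine (VectorMeasure.norm_integral_le_of_norm_le_const (C := C * ‖x‖)
        (ae_of_all _ fun s => (T.toFun s).le_of_opNorm_le (hC s) x)).trans (le_of_eq (by ring)))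

end BoundedC0Semigroup

/-- `f = 𝓛 μ` on `(0, ∞)`, where `(𝓛 μ)(z) = ∫ e^{-zs} μ(ds)`. -/
def IsLaplaceOf (f : ℝ → ℂ) (μ : ComplexMeasure ℝ≥0) : Prop :=
  ∀ z : ℝ, 0 < z →
    f z = μ.integral (fun s : ℝ≥0 => Complex.exp (-((z : ℂ) * (s : ℝ)))) (ContinuousLinearMap.mul ℝ ℂ)

/-- The algebra `A¹₊(ℂ₊)` of Laplace transforms of bounded complex Borel measures on `[0, ∞)`. Its
elements are holomorphic on the right half-plane and are identified with their restrictions to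
`(0, ∞)`, by which they are determined. -/
def IsA1 (f : ℝ → ℂ) : Prop := ∃ μ : ComplexMeasure ℝ≥0, IsLaplaceOf f μ

namespace BoundedC0Semigroup

variable {X : Type*} [NormedAddCommGroup X] [NormedSpace ℂ X] [CompleteSpace X]

open Classical in
/-- The Hille-Phillips functional calculus: `f(A) x = ∫ e^{-sA} x μ(ds)` for `f = 𝓛 μ`. The measure
`μ` is determined by `f`. (The value is `0` for `f` outside the algebra `A¹₊(ℂ₊)`.) -/
def hpCalc (T : BoundedC0Semigroup X) (f : ℝ → ℂ) : X →L[ℂ] X :=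
  if h : IsA1 f then T.integralOp h.choose else 0

/-- `e` regularizes `f`: `e` and `e f` belong to `A¹₊(ℂ₊)` and `e(A)` is injective. -/
def IsRegularizer (T : BoundedC0Semigroup X) (f e : ℝ → ℂ) : Prop :=
  IsA1 e ∧ IsA1 (fun z => e z * f z) ∧ Function.Injective (T.hpCalc e)

open Classical in
/-- The extended Hille-Phillips calculus: `f(A) = e(A)⁻¹ (e f)(A)`, with domain
`{x | (e f)(A) x ∈ ran e(A)}`, where `e` is a regularizer for `f`. The operator does not depend on
the choice of `e`. (For a function `f` without regularizer the value is the operator with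
domain `{0}`.) -/
def extCalc (T : BoundedC0Semigroup X) (f : ℝ → ℂ) : X →ₗ.[ℂ] X :=
  if h : ∃ e, T.IsRegularizer f e then
    { domain := (LinearMap.range (T.hpCalc h.choose : X →ₗ[ℂ] X)).comap
        (T.hpCalc (fun z => h.choose z * f z) : X →ₗ[ℂ] X)
      toFun := ((LinearEquiv.ofInjective (T.hpCalc h.choose : X →ₗ[ℂ] X)
          h.choose_spec.2.2).symm : _ →ₗ[ℂ] X).comp
        (((T.hpCalc (fun z => h.choose z * f z) : X →ₗ[ℂ] X).domRestrict _).codRestrict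
          (LinearMap.range (T.hpCalc h.choose : X →ₗ[ℂ] X)) fun x => x.2) }
  else ⊥

/-- The fractional power `A^α`, given by the extended calculus applied to `z ↦ z^α`. -/
def fracPow (T : BoundedC0Semigroup X) (α : ℝ) : X →ₗ.[ℂ] X :=
  T.extCalc fun z => ((z ^ α : ℝ) : ℂ)

/-- `g(A)` for a real function `g` on `(0, ∞)`. -/
def realCalc (T : BoundedC0Semigroup X) (g : ℝ → ℝ) : X →L[ℂ] X :=
  T.hpCalc fun z => (g z : ℂ)

end BoundedC0Semigroup

/-- `Δ₀^g(z) = g(z) - e^{-z}`. -/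
def deltaZero (g : ℝ → ℝ) (z : ℝ) : ℝ := g z - Real.exp (-z)

end

/-! Everything reduces to averaging an orbit against a probability measure. By Bernstein's theorem
`g` is the Laplace transform of a positive measure `ν`; the normalizations `g(0) = 1` and `g'(0) =
-1` say that `ν` is a probability measure with mean `1`. Hence `Δ₀^g(A)x` is the `ν`-average of
`e^{-sA}x - e^{-A}x`. Likewise `g^n(tA/n)x` is the expectation of `e^{-(tS/n)A}x`, where `S` is a
sum of `n` independent variables with law `ν`.

Two inputs remain. The first is regularity of orbits: for `x ∈ dom(A)` the orbit is Lipschitz with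
constant `M‖Ax‖`, and for `x ∈ dom(A^α)` it is `α`-Hölder with constant `4M‖A^α x‖`. The latter
holds because `z^{-α}(1 - e^{-rz})` is the Laplace transform of an explicit signed density with `L¹`
norm at most `4r^α` (`exists_measures_laplace_sub_eq`). Multiplicativity of the calculus carries
this to operators (`sub_orbit_eq_of_mem_fracPow`).

The second is a bound for the mean absolute deviation. For one variable it equals `2L[g]`, since the
mean is `1`. For `S/n` the second moment may be infinite, so each variable is truncated at level
`n`; both parts are controlled by `1 + g'(1/n) = ∫ s(1 - e^{-s/n}) ν(ds)`, which gives the deviation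
bound `6√(1 + g'(1/n))` (`integral_abs_average_sub_one_le`). Jensen's inequality for the concave
power `α` covers the Hölder case. The constants in the theorem are weaker than what this yields. -/

noncomputable section

/-! ### Taylor expansion of absolutely monotone sequences of derivatives -/

/-- The Taylor remainder of order `N` at `0` of the `k`-th function in a chain of derivatives. -/
def taylorRem (f : ℕ → ℝ → ℝ) (N k : ℕ) (t : ℝ) : ℝ :=
  f k t - ∑ j ∈ Finset.range N, f (k + j) 0 * t ^ j / j.factorial

theorem hasDerivAt_taylorRem {f : ℕ → ℝ → ℝ} {t : ℝ}
    (hf : ∀ k, HasDerivAt (f k) (f (k + 1) t) t) (N k : ℕ) :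
    HasDerivAt (taylorRem f (N + 1) k) (taylorRem f N (k + 1) t) t := by
  unfold taylorRem
  refine (hf k).sub ?_
  have h : HasDerivAt (fun t => ∑ j ∈ Finset.range (N + 1), f (k + j) 0 * t ^ j / j.factorial)
      (∑ j ∈ Finset.range (N + 1), f (k + j) 0 * (j * t ^ (j - 1)) / j.factorial) t :=
    HasDerivAt.fun_sum fun j _ => ((hasDerivAt_pow j t).const_mul _).div_const _
  refine h.congr_deriv ?_
  rw [Finset.sum_range_succ']
  simp only [Nat.cast_zero, zero_mul, mul_zero, zero_div, add_zero]
  refine Finset.sum_congr rfl fun j _ => ?_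
  have : (j.factorial : ℝ) ≠ 0 := by positivity
  have : ((j : ℝ) + 1) ≠ 0 := by positivity
  rw [Nat.factorial_succ, show k + 1 + j = k + (j + 1) by ring, Nat.add_sub_cancel]
  push_cast
  field_simp

theorem taylorRem_succ_zero (f : ℕ → ℝ → ℝ) (N k : ℕ) : taylorRem f (N + 1) k 0 = 0 := by
  unfold taylorRem
  rw [Finset.sum_range_succ']
  simp

/-- Nonnegativity from a nonnegative derivative. -/
theorem nonneg_of_hasDerivAt_nonneg {a : ℝ} {f f' : ℝ → ℝ}
    (hf : ∀ t ∈ Ico 0 a, HasDerivAt f (f' t) t) (h0 : 0 ≤ f 0)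
    (hf' : ∀ t ∈ Ico 0 a, 0 ≤ f' t) : ∀ t ∈ Ico 0 a, 0 ≤ f t := by
  have hm : MonotoneOn f (Ico 0 a) := by
    refine monotoneOn_of_deriv_nonneg (convex_Ico 0 a)
      (fun t ht => (hf t ht).continuousAt.continuousWithinAt)
      (fun t ht => (hf t (interior_subset ht)).differentiableAt.differentiableWithinAt)
      fun t ht => ?_
    rw [(hf t (interior_subset ht)).deriv]
    exact hf' t (interior_subset ht)
  intro t ht
  exact h0.trans (hm ⟨le_rfl, ht.1.trans_lt ht.2⟩ ht ht.1)

/-- Induction on the order: differentiating a remainder of order `N + 1` gives the order `N`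
remainder of the next function in the chain, and the remainder vanishes at `0`. -/
theorem taylorRem_nonneg {a : ℝ} {f : ℕ → ℝ → ℝ}
    (hf : ∀ k, ∀ t ∈ Ico 0 a, HasDerivAt (f k) (f (k + 1) t) t)
    (h0 : ∀ k, ∀ t ∈ Ico 0 a, 0 ≤ f k t) (N : ℕ) :
    ∀ k, ∀ t ∈ Ico 0 a, 0 ≤ taylorRem f N k t := by
  induction N with
  | zero => intro k t ht; simpa [taylorRem] using h0 k t ht
  | succ N ih =>
    intro k
    exact nonneg_of_hasDerivAt_nonneg
      (fun t ht => hasDerivAt_taylorRem (fun k => hf k t ht) N k)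
      (taylorRem_succ_zero f N k).ge (ih (k + 1))

/-- Equivalent to monotonicity of `R_N(t) / t^N`. The same induction applies: the difference of the
two sides vanishes at `0` and its derivative is the previous case times `c`. -/
theorem taylorRem_mul_le {a : ℝ} {f : ℕ → ℝ → ℝ}
    (hf : ∀ k, ∀ t ∈ Ico 0 a, HasDerivAt (f k) (f (k + 1) t) t)
    (h0 : ∀ k, ∀ t ∈ Ico 0 a, 0 ≤ f k t) {c : ℝ} (hc0 : 0 ≤ c) (hc1 : c ≤ 1) (N : ℕ) :
    ∀ k, ∀ t ∈ Ico 0 a, taylorRem f N k (c * t) ≤ c ^ N * taylorRem f N k t := by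
  have hmem : ∀ t ∈ Ico 0 a, c * t ∈ Ico 0 a := fun t ht =>
    ⟨mul_nonneg hc0 ht.1, (mul_le_of_le_one_left ht.1 hc1).trans_lt ht.2⟩
  induction N with
  | zero =>
    intro k t ht
    have hm : MonotoneOn (f k) (Ico 0 a) := by
      refine monotoneOn_of_deriv_nonneg (convex_Ico 0 a)
        (fun t ht => (hf k t ht).continuousAt.continuousWithinAt)
        (fun t ht => (hf k t (interior_subset ht)).differentiableAt.differentiableWithinAt)
        fun t ht => ?_
      rw [(hf k t (interior_subset ht)).deriv]
      exact h0 _ t (interior_subset ht)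
    simpa [taylorRem] using hm (hmem t ht) ht (mul_le_of_le_one_left ht.1 hc1)
  | succ N ih =>
    intro k t ht
    have key := nonneg_of_hasDerivAt_nonneg (a := a)
      (f := fun t => c ^ (N + 1) * taylorRem f (N + 1) k t - taylorRem f (N + 1) k (c * t))
      (f' := fun t => c ^ (N + 1) * taylorRem f N (k + 1) t - taylorRem f N (k + 1) (c * t) * c)
      (fun t ht => ((hasDerivAt_taylorRem (fun k => hf k t ht) N k).const_mul _).sub
        ((hasDerivAt_taylorRem (fun k => hf k _ (hmem t ht)) N k).comp t
          (by simpa using (hasDerivAt_id t).const_mul c)))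
      (by simp [taylorRem_succ_zero])
      (fun t ht => by
        have := mul_le_mul_of_nonneg_right (ih (k + 1) t ht) hc0
        rw [pow_succ]; linarith) t ht
    simpa using key

/-- Bernstein's little theorem: the Taylor series of an absolutely monotone function converges. -/
theorem tendsto_taylor_of_absolutelyMonotone {a : ℝ} {f : ℕ → ℝ → ℝ}
    (hf : ∀ k, ∀ t ∈ Ico 0 a, HasDerivAt (f k) (f (k + 1) t) t)
    (h0 : ∀ k, ∀ t ∈ Ico 0 a, 0 ≤ f k t) {t : ℝ} (ht : t ∈ Ico 0 a) :
    Tendsto (fun N => ∑ j ∈ Finset.range N, f j 0 * t ^ j / j.factorial) atTop (𝓝 (f 0 t)) := by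
  -- Comparison with a point `b > t` makes the remainder at `t` at most `(t / b)^N f(b)`, a
  -- geometric decay.
  obtain ⟨b, hb1, hb2⟩ := exists_between ht.2
  have hb0 : 0 < b := ht.1.trans_lt hb1
  have hb : b ∈ Ico 0 a := ⟨hb0.le, hb2⟩
  have hc1 : t / b < 1 := (div_lt_one hb0).2 hb1
  have hR : Tendsto (fun N => taylorRem f N 0 t) atTop (𝓝 0) := by
    refine squeeze_zero (g := fun N => (t / b) ^ N * f 0 b)
      (fun N => taylorRem_nonneg hf h0 N 0 t ht) (fun N => ?_) ?_
    · have h1 := taylorRem_mul_le hf h0 (div_nonneg ht.1 hb0.le) hc1.le N 0 b hb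
      rw [div_mul_cancel₀ _ hb0.ne'] at h1
      refine h1.trans (mul_le_mul_of_nonneg_left ?_ (pow_nonneg (div_nonneg ht.1 hb0.le) _))
      refine sub_le_self _ (Finset.sum_nonneg fun j _ => ?_)
      have := h0 (0 + j) 0 ⟨le_rfl, hb0.trans hb2⟩
      positivity
    · simpa using (tendsto_pow_atTop_nhds_zero_of_lt_one (div_nonneg ht.1 hb0.le) hc1).mul_const
        (f 0 b)
  have := tendsto_const_nhds (x := f 0 t) |>.sub hR
  simpa [taylorRem] using this

theorem taylor_le_of_absolutelyMonotone {a : ℝ} {f : ℕ → ℝ → ℝ}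
    (hf : ∀ k, ∀ t ∈ Ico 0 a, HasDerivAt (f k) (f (k + 1) t) t)
    (h0 : ∀ k, ∀ t ∈ Ico 0 a, 0 ≤ f k t) {t : ℝ} (ht : t ∈ Ico 0 a) (N : ℕ) :
    ∑ j ∈ Finset.range N, f j 0 * t ^ j / j.factorial ≤ f 0 t := by
  have := taylorRem_nonneg hf h0 N 0 t ht
  simpa [taylorRem] using this

/-! ### Bernstein's theorem -/

namespace IsCompletelyMonotone

theorem hasDerivAt_iteratedDeriv {g : ℝ → ℝ} (hg : IsCompletelyMonotone g) (k : ℕ) {z : ℝ}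
    (hz : 0 < z) : HasDerivAt (iteratedDeriv k g) (iteratedDeriv (k + 1) g z) z := by
  have hd : DifferentiableAt ℝ (iteratedDeriv k g) z := by
    have h1 := (hg.1.differentiableOn_iteratedDerivWithin (m := k)
      (by exact_mod_cast WithTop.coe_lt_top k) (uniqueDiffOn_Ioi 0)).differentiableAt
      (Ioi_mem_nhds hz)
    refine h1.congr_of_eventuallyEq ?_
    filter_upwards [Ioi_mem_nhds hz] with y hy
    exact (iteratedDerivWithin_of_isOpen isOpen_Ioi hy).symm
  rw [iteratedDeriv_succ]
  exact hd.hasDerivAt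

/-- The derivatives of `t ↦ g (a - t)`. -/
theorem hasDerivAt_reflected {g : ℝ → ℝ} (hg : IsCompletelyMonotone g) {a : ℝ} (k : ℕ) {t : ℝ}
    (ht : t ∈ Ico 0 a) :
    HasDerivAt (fun t => (-1 : ℝ) ^ k * iteratedDeriv k g (a - t))
      ((-1 : ℝ) ^ (k + 1) * iteratedDeriv (k + 1) g (a - t)) t := by
  have h := (hg.hasDerivAt_iteratedDeriv k (sub_pos.2 ht.2)).comp t
    ((hasDerivAt_id t).const_sub a)
  refine (h.const_mul ((-1 : ℝ) ^ k)).congr_deriv ?_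
  rw [pow_succ]
  ring

theorem reflected_nonneg {g : ℝ → ℝ} (hg : IsCompletelyMonotone g) {a : ℝ} (k : ℕ) {t : ℝ}
    (ht : t ∈ Ico 0 a) : 0 ≤ (-1 : ℝ) ^ k * iteratedDeriv k g (a - t) :=
  hg.2 k _ (sub_pos.2 ht.2)

end IsCompletelyMonotone

/-- The continuous function `y ↦ y ^ z` on the unit interval. -/
def unitRpow (z : ℝ) (hz : 0 < z) : BoundedContinuousFunction unitInterval ℝ :=
  BoundedContinuousFunction.mkOfCompact
    ⟨fun y => (y : ℝ) ^ z, continuous_subtype_val.rpow_const fun _ => Or.inr hz.le⟩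

/-- Weak compactness of measures of mass at most `1` on a compact space. The variable is `y =
e^{-s}`, so that `[0, ∞]` becomes the unit interval and `e^{-zs}` becomes the continuous function
`y^z`. A limit along an ultrafilter replaces a subsequence. -/
theorem exists_finiteMeasure_of_tendsto {h : ℝ → ℝ} (ρ : ℕ → FiniteMeasure unitInterval)
    (hmass : ∀ n, (ρ n).mass ≤ 1)
    (hlim : ∀ z : ℝ, 0 < z →
      Tendsto (fun n => ∫ y, (y : ℝ) ^ z ∂(ρ n : Measure unitInterval)) atTop (𝓝 (h z))) :
    ∃ ρ' : FiniteMeasure unitInterval, ρ'.mass ≤ 1 ∧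
      ∀ z : ℝ, 0 < z → ∫ y, (y : ℝ) ^ z ∂(ρ' : Measure unitInterval) = h z := by
  have hc := isCompact_setOfPred_finiteMeasure_le_of_compactSpace unitInterval 1
  obtain ⟨ρ', hρ', hle⟩ := hc.ultrafilter_le_nhds' ((Ultrafilter.map ρ (hyperfilter ℕ)))
    (Eventually.of_forall (f := (hyperfilter ℕ : Filter ℕ)) hmass)
  refine ⟨ρ', hρ', fun z hz => ?_⟩
  have ht : Tendsto ρ (hyperfilter ℕ) (𝓝 ρ') := hle
  have h1 := FiniteMeasure.tendsto_iff_forall_integral_tendsto.1 ht (unitRpow z hz)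
  have h2 := (hlim z hz).mono_left (Nat.hyperfilter_le_atTop)
  exact tendsto_nhds_unique h1 h2

/-- The point `e^{-s}` of the unit interval. -/
def unitExp (s : ℝ≥0) : unitInterval := ⟨Real.exp (-s), (Real.exp_pos _).le, by simp⟩

/-- The Taylor polynomial at `0` of `t ↦ g (a - t)`, evaluated at `t = a e^{-z/a}`, is a positive
combination of the exponentials `e^{-jz/a}`. It is thus the transform of atoms at `s = j / a`. -/
theorem exists_discrete_measure {g : ℝ → ℝ} (hg : IsB1 g) {a : ℝ≥0} (ha : 0 < a) (N : ℕ) :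
    ∃ ρ : FiniteMeasure unitInterval, ρ.mass ≤ 1 ∧ ∀ z : ℝ, 0 < z →
      ∫ y, (y : ℝ) ^ z ∂(ρ : Measure unitInterval) =
        ∑ j ∈ Finset.range N, ((-1 : ℝ) ^ j * iteratedDeriv j g a) *
          (a * Real.exp (-(z / a))) ^ j / j.factorial := by
  have hcm := hg.completelyMonotone
  have ha' : (0 : ℝ) < a := ha
  have hw : ∀ j : ℕ, 0 ≤ ((-1 : ℝ) ^ j * iteratedDeriv j g a) * (a : ℝ) ^ j / j.factorial :=
    fun j => by have := hcm.2 j a ha'; positivity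
  have hsum : ∑ j ∈ Finset.range N, ((-1 : ℝ) ^ j * iteratedDeriv j g a) * (a : ℝ) ^ j /
      j.factorial ≤ 1 := by
    have hbd : ∀ t ∈ Ico (0 : ℝ) a, ∑ j ∈ Finset.range N, ((-1 : ℝ) ^ j * iteratedDeriv j g a) *
        t ^ j / j.factorial ≤ g (a - t) := fun t ht => by
      have := taylor_le_of_absolutelyMonotone (f := fun k t => (-1 : ℝ) ^ k *
        iteratedDeriv k g (a - t)) (fun k t ht => hcm.hasDerivAt_reflected k ht)
        (fun k t ht => hcm.reflected_nonneg k ht) ht N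
      simpa using this
    have h1 : Tendsto (fun t : ℝ => ∑ j ∈ Finset.range N, ((-1 : ℝ) ^ j * iteratedDeriv j g a) *
        t ^ j / j.factorial) (𝓝[<] (a : ℝ)) (𝓝 (∑ j ∈ Finset.range N,
          ((-1 : ℝ) ^ j * iteratedDeriv j g a) * (a : ℝ) ^ j / j.factorial)) :=
      (Continuous.tendsto (by fun_prop) _).mono_left nhdsWithin_le_nhds
    -- The total mass is the Taylor polynomial at the endpoint `t = a`, reached as a limit from the
    -- left; this is where `g(0+) = 1` bounds it.
    have h2 : Tendsto (fun t : ℝ => g (a - t)) (𝓝[<] (a : ℝ)) (𝓝 1) := by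
      refine hg.value_zero.comp (tendsto_nhdsWithin_iff.2 ⟨?_, ?_⟩)
      · have : Tendsto (fun t : ℝ => (a : ℝ) - t) (𝓝 (a : ℝ)) (𝓝 (a - a)) :=
          (continuous_const.sub continuous_id).tendsto _
        rw [sub_self] at this
        exact this.mono_left nhdsWithin_le_nhds
      · filter_upwards [self_mem_nhdsWithin] with t ht
        exact sub_pos.2 (mem_Iio.1 ht)
    refine le_of_tendsto_of_tendsto h1 h2 ?_
    filter_upwards [Ioo_mem_nhdsLT ha'] with t ht
    exact hbd t ⟨ht.1.le, ht.2⟩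
  let m : Measure unitInterval := ∑ j ∈ Finset.range N,
    ENNReal.ofReal (((-1 : ℝ) ^ j * iteratedDeriv j g a) * (a : ℝ) ^ j / j.factorial) •
      Measure.dirac (unitExp (j / a))
  have hm : m univ ≤ 1 := by
    simp only [m, Measure.coe_finsetSum, Finset.sum_apply, Measure.smul_apply, measure_univ,
      smul_eq_mul, mul_one]
    rw [← ENNReal.ofReal_sum_of_nonneg fun j _ => hw j]
    exact ENNReal.ofReal_le_one.2 hsum
  have : IsFiniteMeasure m := ⟨hm.trans_lt ENNReal.one_lt_top⟩
  refine ⟨(⟨m, this⟩ : FiniteMeasure unitInterval), ?_, fun z hz => ?_⟩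
  · exact ENNReal.toNNReal_mono ENNReal.one_ne_top hm
  · show ∫ y, (y : ℝ) ^ z ∂m = _
    rw [integral_finsetSum_measure fun j _ => ?_]
    · refine Finset.sum_congr rfl fun j _ => ?_
      rw [integral_smul_measure, integral_dirac, ENNReal.toReal_ofReal (hw j)]
      simp only [unitExp, smul_eq_mul, NNReal.coe_div, NNReal.coe_natCast]
      rw [← Real.exp_mul, mul_pow, ← Real.exp_nat_mul]
      rw [show -((j : ℝ) / a) * z = j * -(z / a) by ring]
      ring
    · exact ((unitRpow z hz).integrable _).smul_measure ENNReal.ofReal_ne_top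

theorem exists_unitInterval_measure {g : ℝ → ℝ} (hg : IsB1 g) :
    ∃ ρ : FiniteMeasure unitInterval, ∀ z : ℝ, 0 < z →
      ∫ y, (y : ℝ) ^ z ∂(ρ : Measure unitInterval) = g z := by
  have hcm := hg.completelyMonotone
  -- First limit: with `a = n + 1` fixed, the order of the Taylor polynomial tends to infinity.
  have h1 : ∀ n : ℕ, ∃ ρ : FiniteMeasure unitInterval, ρ.mass ≤ 1 ∧ ∀ z : ℝ, 0 < z →
      ∫ y, (y : ℝ) ^ z ∂(ρ : Measure unitInterval) =
        g ((n + 1 : ℝ) - (n + 1) * Real.exp (-(z / (n + 1)))) := by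
    intro n
    have hn : (0 : ℝ≥0) < n + 1 := by positivity
    choose ρ hρ1 hρ2 using exists_discrete_measure hg hn
    refine exists_finiteMeasure_of_tendsto ρ hρ1 fun z hz => ?_
    simp only [hρ2 _ z hz]
    have hn' : (0 : ℝ) < n + 1 := by positivity
    have he : Real.exp (-(z / (n + 1))) < 1 := by
      rw [Real.exp_lt_one_iff, neg_lt_zero]; positivity
    have ht : (n + 1 : ℝ) * Real.exp (-(z / (n + 1))) ∈ Ico (0 : ℝ) (n + 1) :=
      ⟨by positivity, mul_lt_of_lt_one_right hn' he⟩
    have := tendsto_taylor_of_absolutelyMonotone (f := fun k t => (-1 : ℝ) ^ k *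
        iteratedDeriv k g ((n + 1 : ℝ) - t)) (fun k t ht => hcm.hasDerivAt_reflected k ht)
        (fun k t ht => hcm.reflected_nonneg k ht) ht
    simpa using this
  choose ρ hρ1 hρ2 using h1
  -- Second limit `a → ∞`: `a(1 - e^{-z/a})` tends to `z`, being a difference quotient at `0` of `u
  -- ↦ -e^{-zu}`.
  obtain ⟨ρ', -, h⟩ := exists_finiteMeasure_of_tendsto (h := g) ρ hρ1 fun z hz => by
    simp only [hρ2 _ z hz]
    have hcont : ContinuousAt g z :=
      (hcm.1.continuousOn).continuousAt (Ioi_mem_nhds hz)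
    refine hcont.tendsto.comp ?_
    have hd : HasDerivAt (fun u : ℝ => -Real.exp (-(z * u))) z 0 := by
      have h0 : HasDerivAt (fun u : ℝ => -(z * u)) (-z) 0 := by
        simpa using ((hasDerivAt_id (0 : ℝ)).const_mul z).fun_neg
      simpa using h0.exp.fun_neg
    have hs := hd.tendsto_slope_zero_right
    have hu : Tendsto (fun n : ℕ => (1 : ℝ) / (n + 1)) atTop (𝓝[>] 0) :=
      tendsto_nhdsWithin_iff.2 ⟨tendsto_one_div_add_atTop_nhds_zero_nat,
        Eventually.of_forall fun n => by simp only [mem_Ioi]; positivity⟩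
    refine (hs.comp hu).congr fun n => ?_
    have hn' : (n + 1 : ℝ) ≠ 0 := by positivity
    simp only [Function.comp_apply, zero_add, mul_zero, neg_zero, Real.exp_zero, smul_eq_mul]
    rw [show z * (1 / ((n : ℝ) + 1)) = z / (n + 1) by ring]
    field_simp
    ring
  exact ⟨ρ', h⟩

/-- Bernstein's theorem for the class `𝓑₁`. -/
theorem IsB1.exists_isRepresentedBy {g : ℝ → ℝ} (hg : IsB1 g) :
    ∃ ν : Measure ℝ≥0, IsFiniteMeasure ν ∧ IsRepresentedBy g ν := by
  obtain ⟨ρ, hρ⟩ := exists_unitInterval_measure hg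
  -- The point `y = 0` corresponds to `s = ∞`. Mass there can be discarded because `y^z` vanishes at
  -- `0` for `z > 0`.
  let S : Set unitInterval := {y | (y : ℝ) ≠ 0}
  have hS : MeasurableSet S := (measurable_subtype_coe (measurableSet_singleton (0 : ℝ))).compl
  let φ : unitInterval → ℝ≥0 := fun y => (-Real.log y).toNNReal
  have hφ : Measurable φ := (Real.measurable_log.comp measurable_subtype_coe).neg.real_toNNReal
  have hexp : ∀ z : ℝ, ∀ y ∈ S, Real.exp (-(z * (φ y : ℝ))) = (y : ℝ) ^ z := fun z y hy => by
    have hy0 : 0 < (y : ℝ) := lt_of_le_of_ne y.2.1 (Ne.symm hy)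
    have hl : 0 ≤ -Real.log y := neg_nonneg.2 (Real.log_nonpos y.2.1 y.2.2)
    rw [Real.rpow_def_of_pos hy0]
    simp only [φ, Real.coe_toNNReal _ hl]
    ring_nf
  have hmeas : ∀ z : ℝ, Measurable fun s : ℝ≥0 => Real.exp (-(z * s)) := fun z => by fun_prop
  have hfin : IsFiniteMeasure (((ρ : Measure unitInterval).restrict S).map φ) := inferInstance
  refine ⟨((ρ : Measure unitInterval).restrict S).map φ, hfin, fun z hz => ⟨?_, ?_⟩⟩
  · refine Integrable.of_bound (hmeas z).aestronglyMeasurable 1 (ae_of_all _ fun s => ?_)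
    rw [Real.norm_eq_abs, Real.abs_exp, Real.exp_le_one_iff, neg_nonpos]
    positivity
  · rw [integral_map hφ.aemeasurable (hmeas z).aestronglyMeasurable,
      setIntegral_congr_fun hS (hexp z), ← hρ z hz,
      setIntegral_eq_integral_of_forall_compl_eq_zero]
    intro y hy
    have : (y : ℝ) = 0 := by simpa [S] using hy
    rw [this, Real.zero_rpow hz.ne']

/-! ### Complex measures as combinations of positive finite measures -/

/-- The vector measure `v • p` for a finite positive measure `p` and a vector `v`. -/
def MeasureTheory.Measure.smulVector {α F : Type*} [MeasurableSpace α] [NormedAddCommGroup F]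
    [NormedSpace ℝ F] (p : Measure α) [IsFiniteMeasure p] (v : F) : VectorMeasure α F :=
  p.toSignedMeasure.mapRange ((ContinuousLinearMap.id ℝ ℝ).smulRight v).toLinearMap.toAddMonoidHom
    ((ContinuousLinearMap.id ℝ ℝ).smulRight v).continuous

namespace MeasureTheory.Measure

variable {α E F G : Type*} [MeasurableSpace α] [NormedAddCommGroup F] [NormedSpace ℝ F]
  [NormedAddCommGroup E] [NormedAddCommGroup G] [NormedSpace ℝ G]

theorem smulVector_apply (p : Measure α) [IsFiniteMeasure p] (v : F) {s : Set α}
    (hs : MeasurableSet s) : p.smulVector v s = p.real s • v := by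
  simp [smulVector, Measure.toSignedMeasure_apply_measurable hs]

theorem variation_smulVector_le (p : Measure α) [IsFiniteMeasure p] (v : F) :
    (p.smulVector v).variation ≤ ‖v‖ₑ • p := by
  refine VectorMeasure.variation_le_of_forall_enorm_le fun s hs => ?_
  rw [smulVector_apply p v hs, enorm_smul, Measure.smul_apply, smul_eq_mul, mul_comm,
    Real.enorm_of_nonneg measureReal_nonneg, ofReal_measureReal]

/-- Reduces integration against a vector measure to the Bochner integral, where Fubini, dominated
convergence and change of variables are at hand. -/
theorem integral_smulVector [NormedSpace ℝ E] [CompleteSpace G] {p : Measure α}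
    [IsFiniteMeasure p] {f : α → E} (hf : Integrable f p) (v : F) (B : E →L[ℝ] F →L[ℝ] G) :
    (p.smulVector v).integral f B = ∫ a, B (f a) v ∂p := by
  have hT : DominatedFinMeasAdditive p ((p.smulVector v).transpose B) (‖B‖ * ‖v‖) := by
    refine ⟨fun s t hs ht _ _ hd => cbmApplyMeasure_union _ B hs ht hd, fun s hs _ => ?_⟩
    refine (norm_cbmApplyMeasure_le _ B s).trans (le_of_eq ?_)
    rw [smulVector_apply p v hs, norm_smul, Real.norm_of_nonneg measureReal_nonneg]
    ring
  -- Since the variation is at most `‖v‖ p`, the control measure can be replaced by `p`; both sides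
  -- can then be compared by induction on integrable functions.
  have h1 : (p.smulVector v).integral f B = setToFun p _ hT f :=
    (setToFun_congr_measure_of_integrable ‖v‖ₑ enorm_ne_top (variation_smulVector_le p v)
      hT _ f hf).symm
  rw [h1]
  refine Integrable.induction (P := fun f => setToFun p _ hT f = ∫ a, B (f a) v ∂p)
    (fun c s hs hsf => ?_) (fun f g _ hf hg h1 h2 => ?_) ?_ (fun f g hfg _ h => ?_) hf
  · rw [setToFun_indicator_const hT hs hsf.ne]
    have : (fun a => B (s.indicator (fun _ => c) a) v) = s.indicator (fun _ => B c v) := by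
      ext a; by_cases ha : a ∈ s <;> simp [ha]
    rw [this, integral_indicator_const _ hs]
    change B c (p.smulVector v s) = _
    rw [smulVector_apply p v hs, map_smul]
  · rw [setToFun_add hT hf hg, h1, h2, ← integral_add]
    · simp
    · exact (B.flip v).integrable_comp hf
    · exact (B.flip v).integrable_comp hg
  · refine isClosed_eq (continuous_setToFun hT) ?_
    refine (continuous_integral.comp ((B.flip v).compLpL 1 p).continuous).congr fun f => ?_
    exact integral_congr_ae ((B.flip v).coeFn_compLpL f)
  · rw [← setToFun_congr_ae hT hfg, h]
    refine integral_congr_ae ?_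
    filter_upwards [hfg] with a ha
    rw [ha]

end MeasureTheory.Measure

namespace MeasureTheory.ComplexMeasure

variable {α : Type*} [MeasurableSpace α]

/-- A complex measure is a combination of four finite positive measures. -/
theorem exists_eq_smulVector (μ : ComplexMeasure α) :
    ∃ (p q r s : Measure α) (_ : IsFiniteMeasure p) (_ : IsFiniteMeasure q)
      (_ : IsFiniteMeasure r) (_ : IsFiniteMeasure s),
      μ = (p.smulVector (1 : ℂ) + q.smulVector (-1)) +
        (r.smulVector Complex.I + s.smulVector (-Complex.I)) := by
  have key : ∀ (σ : SignedMeasure α), ∃ (p q : Measure α) (_ : IsFiniteMeasure p)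
      (_ : IsFiniteMeasure q), ∀ s, MeasurableSet s → σ s = p.real s - q.real s := fun σ => by
    refine ⟨σ.toJordanDecomposition.posPart, σ.toJordanDecomposition.negPart,
      σ.toJordanDecomposition.posPart_finite, σ.toJordanDecomposition.negPart_finite,
      fun s hs => ?_⟩
    have := σ.toJordanDecomposition.posPart_finite
    have := σ.toJordanDecomposition.negPart_finite
    conv_lhs => rw [← σ.toSignedMeasure_toJordanDecomposition]
    rw [JordanDecomposition.toSignedMeasure, Measure.toSignedMeasure_sub_apply hs]
  obtain ⟨p, q, hp, hq, h1⟩ := key (ComplexMeasure.re μ)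
  obtain ⟨r, s, hr, hs, h2⟩ := key (ComplexMeasure.im μ)
  refine ⟨p, q, r, s, hp, hq, hr, hs, ?_⟩
  ext A hA
  simp only [add_apply, Measure.smulVector_apply _ _ hA]
  have e3 : μ A = (ComplexMeasure.re μ A : ℂ) + (ComplexMeasure.im μ A : ℂ) * Complex.I :=
    (Complex.re_add_im (μ A)).symm
  rw [e3, h1 A hA, h2 A hA]
  simp only [Complex.real_smul]
  push_cast
  ring

end MeasureTheory.ComplexMeasure

/-! ### Uniqueness of Laplace transforms -/

/-- The bounded continuous function `s ↦ e^{-s}` on `[0, ∞)`. -/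
def expNegBCF : BoundedContinuousFunction ℝ≥0 ℝ :=
  BoundedContinuousFunction.ofNormedAddCommGroup (fun s : ℝ≥0 => Real.exp (-s))
    (by fun_prop) 1 fun s => by simp

theorem integrable_exp_neg_mul (p : Measure ℝ≥0) [IsFiniteMeasure p] {z : ℝ} (hz : 0 ≤ z) :
    Integrable (fun s : ℝ≥0 => Real.exp (-(z * s))) p := by
  refine Integrable.of_bound (by fun_prop) 1 (ae_of_all _ fun s => ?_)
  rw [Real.norm_eq_abs, Real.abs_exp, Real.exp_le_one_iff, neg_nonpos]
  positivity

theorem tendsto_laplace_zero (p : Measure ℝ≥0) [IsFiniteMeasure p] :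
    Tendsto (fun z : ℝ => ∫ s : ℝ≥0, Real.exp (-(z * s)) ∂p) (𝓝[>] 0) (𝓝 (p.real univ)) := by
  have h : Tendsto (fun z : ℝ => ∫ s : ℝ≥0, Real.exp (-(z * s)) ∂p) (𝓝[>] 0)
      (𝓝 (∫ _ : ℝ≥0, (1 : ℝ) ∂p)) := by
    refine tendsto_integral_filter_of_dominated_convergence (fun _ => 1)
      (Eventually.of_forall fun z => by fun_prop) ?_ (integrable_const 1) (ae_of_all _ fun s => ?_)
    · filter_upwards [self_mem_nhdsWithin] with z hz
      refine ae_of_all _ fun s => ?_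
      rw [Real.norm_eq_abs, Real.abs_exp, Real.exp_le_one_iff, neg_nonpos]
      exact mul_nonneg (mem_Ioi.1 hz).le s.2
    · have : Continuous fun z : ℝ => Real.exp (-(z * s)) := by fun_prop
      have h := this.tendsto 0
      simp only [zero_mul, neg_zero, Real.exp_zero] at h
      exact h.mono_left nhdsWithin_le_nhds
  simpa using h

/-- A finite measure on `[0, ∞)` is determined by its Laplace transform. -/
theorem measure_eq_of_laplace_eq {p q : Measure ℝ≥0} [IsFiniteMeasure p] [IsFiniteMeasure q]
    (h : ∀ z : ℝ, 0 < z → ∫ s : ℝ≥0, Real.exp (-(z * s)) ∂p = ∫ s : ℝ≥0, Real.exp (-(z * s)) ∂q) :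
    p = q := by
  -- Polynomials in `e^{-s}` form a point-separating algebra, so they determine a finite measure;
  -- only the transform at natural numbers is needed.
  let A : StarSubalgebra ℝ (BoundedContinuousFunction ℝ≥0 ℝ) :=
    { (Polynomial.aeval (R := ℝ) expNegBCF).range with
      star_mem' := fun {a} ha => by
        have : star a = a := by ext s; simp
        rw [this]; exact ha }
  refine ext_of_forall_mem_subalgebra_integral_eq_of_polish (𝕜 := ℝ) (A := A) ?_ ?_
  · intro x y hxy
    refine ⟨_, ⟨_, ⟨expNegBCF, ⟨Polynomial.X, by simp⟩, rfl⟩, rfl⟩, ?_⟩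
    simpa [expNegBCF] using hxy
  · rintro g ⟨P, rfl⟩
    have hval : ∀ s : ℝ≥0, (Polynomial.aeval (R := ℝ) expNegBCF P) s =
        ∑ i ∈ Finset.range (P.natDegree + 1), P.coeff i * Real.exp (-((i : ℝ) * s)) := fun s => by
      rw [Polynomial.aeval_eq_sum_range, BoundedContinuousFunction.coe_sum, Finset.sum_apply]
      refine Finset.sum_congr rfl fun i _ => ?_
      simp [expNegBCF, ← Real.exp_nat_mul]
    have hnat : ∀ i : ℕ, ∫ s : ℝ≥0, Real.exp (-((i : ℝ) * s)) ∂p =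
        ∫ s : ℝ≥0, Real.exp (-((i : ℝ) * s)) ∂q := fun i => by
      rcases Nat.eq_zero_or_pos i with rfl | hi
      -- The constant term requires equality of total masses, obtained by letting `z → 0+` in the
      -- hypothesis.
      · have := tendsto_nhds_unique (tendsto_laplace_zero p) ((tendsto_laplace_zero q).congr' (by
          filter_upwards [self_mem_nhdsWithin] with z hz using (h z hz).symm))
        simpa using this
      · exact h i (by exact_mod_cast hi)
    simp only [AlgHom.toRingHom_eq_coe, RingHom.coe_coe, hval]
    rw [integral_finsetSum _ fun i _ => (integrable_exp_neg_mul p (Nat.cast_nonneg i)).const_mul _,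
      integral_finsetSum _ fun i _ => (integrable_exp_neg_mul q (Nat.cast_nonneg i)).const_mul _]
    refine Finset.sum_congr rfl fun i _ => ?_
    rw [integral_const_mul, integral_const_mul, hnat]

theorem cexp_neg_mul_ofReal (z : ℝ) (s : ℝ≥0) :
    Complex.exp (-((z : ℂ) * (s : ℝ))) = (Real.exp (-(z * s)) : ℂ) := by
  push_cast; rfl

theorem integrable_cexp_neg_mul (p : Measure ℝ≥0) [IsFiniteMeasure p] {z : ℝ} (hz : 0 ≤ z) :
    Integrable (fun s : ℝ≥0 => Complex.exp (-((z : ℂ) * (s : ℝ)))) p := by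
  simp only [cexp_neg_mul_ofReal]
  exact (integrable_exp_neg_mul p hz).ofReal

theorem ComplexMeasure.integrable_cexp_neg_mul (μ : ComplexMeasure ℝ≥0) {z : ℝ} (hz : 0 ≤ z) :
    μ.Integrable (fun s : ℝ≥0 => Complex.exp (-((z : ℂ) * (s : ℝ)))) := by
  have := ComplexMeasure.isFiniteMeasure_variation μ
  exact _root_.integrable_cexp_neg_mul _ hz

/-- The Laplace transform of a positive measure on `[0, ∞)`. -/
def laplace (p : Measure ℝ≥0) (z : ℝ) : ℝ := ∫ s : ℝ≥0, Real.exp (-(z * s)) ∂p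

theorem IsLaplaceOf.smulVector (p : Measure ℝ≥0) [IsFiniteMeasure p] (v : ℂ) :
    IsLaplaceOf (fun z => v * laplace p z) (p.smulVector v) := by
  intro z hz
  rw [Measure.integral_smulVector (integrable_cexp_neg_mul p hz.le)]
  simp only [ContinuousLinearMap.mul_apply', integral_mul_const, cexp_neg_mul_ofReal,
    integral_complex_ofReal, laplace]
  rw [mul_comm]

theorem IsLaplaceOf.add {f g : ℝ → ℂ} {μ ν : ComplexMeasure ℝ≥0} (hf : IsLaplaceOf f μ)
    (hg : IsLaplaceOf g ν) : IsLaplaceOf (fun z => f z + g z) (μ + ν) := fun z hz => by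
  rw [VectorMeasure.integral_add_vectorMeasure (ComplexMeasure.integrable_cexp_neg_mul μ hz.le)
    (ComplexMeasure.integrable_cexp_neg_mul ν hz.le), ← hf z hz, ← hg z hz]

theorem IsLaplaceOf.sub {f g : ℝ → ℂ} {μ ν : ComplexMeasure ℝ≥0} (hf : IsLaplaceOf f μ)
    (hg : IsLaplaceOf g ν) : IsLaplaceOf (fun z => f z - g z) (μ - ν) := fun z hz => by
  rw [VectorMeasure.integral_sub_vectorMeasure (ComplexMeasure.integrable_cexp_neg_mul μ hz.le)
    (ComplexMeasure.integrable_cexp_neg_mul ν hz.le), ← hf z hz, ← hg z hz]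

theorem IsLaplaceOf.congr {f g : ℝ → ℂ} {μ : ComplexMeasure ℝ≥0} (hf : IsLaplaceOf f μ)
    (h : ∀ z : ℝ, 0 < z → f z = g z) : IsLaplaceOf g μ := fun z hz => by
  rw [← h z hz, hf z hz]

/-- A complex measure on `[0, ∞)` is determined by its Laplace transform. -/
theorem IsLaplaceOf.unique {f : ℝ → ℂ} {μ ν : ComplexMeasure ℝ≥0} (hμ : IsLaplaceOf f μ)
    (hν : IsLaplaceOf f ν) : μ = ν := by
  rw [← sub_eq_zero]
  -- Write `μ - ν = (p - q) + i(r - s)`. On real `z` the real and imaginary parts of the vanishing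
  -- transform separate, giving `p = q` and `r = s`.
  obtain ⟨p, q, r, s, hp, hq, hr, hs, h⟩ := ComplexMeasure.exists_eq_smulVector (μ - ν)
  have h1 : ∀ z : ℝ, 0 < z → (1 * (laplace p z : ℂ) + -1 * laplace q z) +
      (Complex.I * laplace r z + -Complex.I * laplace s z) = 0 := fun z hz => by
    have e1 := hμ.sub hν z hz
    have e2 := ((IsLaplaceOf.smulVector p 1).add (IsLaplaceOf.smulVector q (-1))).add
      ((IsLaplaceOf.smulVector r Complex.I).add (IsLaplaceOf.smulVector s (-Complex.I))) z hz
    rw [← h, ← e1] at e2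
    exact e2.trans (sub_self _)
  have hpq : p = q := measure_eq_of_laplace_eq fun z hz => by
    have := congrArg Complex.re (h1 z hz)
    simp [laplace] at this
    linarith
  have hrs : r = s := measure_eq_of_laplace_eq fun z hz => by
    have := congrArg Complex.im (h1 z hz)
    simp [laplace] at this
    linarith
  subst hpq hrs
  rw [h]
  ext A hA
  simp [Measure.smulVector_apply _ _ hA]

/-- Induction over `A¹₊(ℂ₊)`. -/
theorem IsA1.induction {P : (ℝ → ℂ) → Prop}
    (hcongr : ∀ f g : ℝ → ℂ, (∀ z : ℝ, 0 < z → f z = g z) → P f → P g)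
    (hsmul : ∀ (v : ℂ) (p : Measure ℝ≥0) [IsFiniteMeasure p], P fun z => v * laplace p z)
    (hadd : ∀ f g : ℝ → ℂ, IsA1 f → IsA1 g → P f → P g → P fun z => f z + g z)
    {f : ℝ → ℂ} (hf : IsA1 f) : P f := by
  obtain ⟨μ, hμ⟩ := hf
  obtain ⟨p, q, r, s, hp, hq, hr, hs, h⟩ := ComplexMeasure.exists_eq_smulVector μ
  have hp1 := IsLaplaceOf.smulVector p 1
  have hq1 := IsLaplaceOf.smulVector q (-1)
  have hr1 := IsLaplaceOf.smulVector r Complex.I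
  have hs1 := IsLaplaceOf.smulVector s (-Complex.I)
  refine hcongr _ _ (fun z hz => ?_) (hadd _ _ ⟨_, hp1.add hq1⟩ ⟨_, hr1.add hs1⟩
    (hadd _ _ ⟨_, hp1⟩ ⟨_, hq1⟩ (hsmul 1 p) (hsmul (-1) q))
    (hadd _ _ ⟨_, hr1⟩ ⟨_, hs1⟩ (hsmul Complex.I r) (hsmul (-Complex.I) s)))
  rw [hμ z hz, h, ← ((hp1.add hq1).add (hr1.add hs1)) z hz]

theorem laplace_dirac (a : ℝ≥0) (z : ℝ) : laplace (Measure.dirac a) z = Real.exp (-(z * a)) := by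
  simp [laplace]

theorem laplace_conv (p q : Measure ℝ≥0) [IsFiniteMeasure p] [IsFiniteMeasure q] {z : ℝ}
    (hz : 0 ≤ z) : laplace (p ∗ q) z = laplace p z * laplace q z := by
  unfold laplace
  rw [integral_conv (integrable_exp_neg_mul _ hz)]
  simp [mul_add, Real.exp_add, integral_const_mul, integral_mul_const, mul_comm]

/-! ### The Hille-Phillips calculus is an algebra homomorphism -/

namespace BoundedC0Semigroup

variable {X : Type*} [NormedAddCommGroup X] [NormedSpace ℂ X]

theorem norm_le_bound (T : BoundedC0Semigroup X) (t : ℝ≥0) : ‖T.toFun t‖ ≤ T.bound := by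
  obtain ⟨C, hC⟩ := T.bounded'
  exact le_ciSup (f := fun t => ‖T.toFun t‖) ⟨C, by rintro _ ⟨t, rfl⟩; exact hC t⟩ t

theorem bound_nonneg (T : BoundedC0Semigroup X) : 0 ≤ T.bound :=
  (norm_nonneg _).trans (T.norm_le_bound 0)

theorem norm_apply_le (T : BoundedC0Semigroup X) (t : ℝ≥0) (x : X) :
    ‖T.toFun t x‖ ≤ T.bound * ‖x‖ :=
  (T.toFun t).le_of_opNorm_le (T.norm_le_bound t) x

theorem integrable_orbit_measure (T : BoundedC0Semigroup X) (p : Measure ℝ≥0) [IsFiniteMeasure p]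
    (x : X) : Integrable (fun s : ℝ≥0 => T.toFun s x) p :=
  Integrable.of_bound (T.continuous' x).aestronglyMeasurable (T.bound * ‖x‖)
    (ae_of_all _ fun s => T.norm_apply_le s x)

variable [CompleteSpace X]

theorem integralOp_apply (T : BoundedC0Semigroup X) (μ : ComplexMeasure ℝ≥0) (x : X) :
    T.integralOp μ x = μ.integral (fun s => T.toFun s x) (ContinuousLinearMap.lsmul ℝ ℂ).flip :=
  rfl

theorem integralOp_smulVector (T : BoundedC0Semigroup X) (p : Measure ℝ≥0) [IsFiniteMeasure p]
    (v : ℂ) (x : X) : T.integralOp (p.smulVector v) x = v • ∫ s, T.toFun s x ∂p := by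
  rw [integralOp_apply, Measure.integral_smulVector (T.integrable_orbit_measure p x)]
  simp [integral_smul]

theorem integralOp_add (T : BoundedC0Semigroup X) (μ ν : ComplexMeasure ℝ≥0) :
    T.integralOp (μ + ν) = T.integralOp μ + T.integralOp ν := by
  ext x
  exact VectorMeasure.integral_add_vectorMeasure (T.integrable_orbit μ x) (T.integrable_orbit ν x)

/-- Uniqueness of Laplace transforms makes the measure selected by choice irrelevant. -/
theorem hpCalc_eq_integralOp (T : BoundedC0Semigroup X) {f : ℝ → ℂ} {μ : ComplexMeasure ℝ≥0}
    (hf : IsLaplaceOf f μ) : T.hpCalc f = T.integralOp μ := by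
  have h : IsA1 f := ⟨μ, hf⟩
  rw [hpCalc, dif_pos h, h.choose_spec.unique hf]

theorem hpCalc_congr (T : BoundedC0Semigroup X) {f g : ℝ → ℂ} (hf : IsA1 f)
    (h : ∀ z : ℝ, 0 < z → f z = g z) : T.hpCalc f = T.hpCalc g := by
  obtain ⟨μ, hμ⟩ := hf
  rw [T.hpCalc_eq_integralOp hμ, T.hpCalc_eq_integralOp (hμ.congr h)]

theorem hpCalc_add (T : BoundedC0Semigroup X) {f g : ℝ → ℂ} (hf : IsA1 f) (hg : IsA1 g) :
    T.hpCalc (fun z => f z + g z) = T.hpCalc f + T.hpCalc g := by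
  obtain ⟨μ, hμ⟩ := hf
  obtain ⟨ν, hν⟩ := hg
  rw [T.hpCalc_eq_integralOp (hμ.add hν), T.hpCalc_eq_integralOp hμ, T.hpCalc_eq_integralOp hν,
    integralOp_add]

theorem hpCalc_smul_laplace (T : BoundedC0Semigroup X) (p : Measure ℝ≥0) [IsFiniteMeasure p]
    (v : ℂ) (x : X) :
    T.hpCalc (fun z => v * laplace p z) x = v • ∫ s, T.toFun s x ∂p := by
  rw [T.hpCalc_eq_integralOp (IsLaplaceOf.smulVector p v), integralOp_smulVector]

theorem hpCalc_laplace (T : BoundedC0Semigroup X) (p : Measure ℝ≥0) [IsFiniteMeasure p] (x : X)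
    {f : ℝ → ℂ} (hf : ∀ z : ℝ, 0 < z → f z = laplace p z) :
    T.hpCalc f x = ∫ s, T.toFun s x ∂p := by
  have h := IsLaplaceOf.smulVector p 1
  rw [← T.hpCalc_congr ⟨_, h⟩ fun z hz => by rw [hf z hz, one_mul], hpCalc_smul_laplace, one_smul]

theorem hpCalc_laplace_sub (T : BoundedC0Semigroup X) (p q : Measure ℝ≥0) [IsFiniteMeasure p]
    [IsFiniteMeasure q] {f : ℝ → ℂ} (hf : ∀ z : ℝ, 0 < z → f z = laplace p z - laplace q z) :
    IsA1 f ∧ ∀ x, T.hpCalc f x = ∫ s, T.toFun s x ∂p - ∫ s, T.toFun s x ∂q := by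
  have hp := IsLaplaceOf.smulVector p 1
  have hq := IsLaplaceOf.smulVector q (-1)
  have hc : ∀ z : ℝ, 0 < z → 1 * (laplace p z : ℂ) + -1 * laplace q z = f z := fun z hz => by
    rw [hf z hz]; ring
  refine ⟨⟨_, (hp.add hq).congr hc⟩, fun x => ?_⟩
  rw [← T.hpCalc_congr ⟨_, hp.add hq⟩ hc, T.hpCalc_add ⟨_, hp⟩ ⟨_, hq⟩, add_apply,
    hpCalc_smul_laplace, hpCalc_smul_laplace, one_smul, neg_smul, one_smul, sub_eq_add_neg]

/-- Fubini and the semigroup law; this is the source of multiplicativity of the calculus. -/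
theorem integral_orbit_conv (T : BoundedC0Semigroup X) (p q : Measure ℝ≥0) [IsFiniteMeasure p]
    [IsFiniteMeasure q] (x : X) :
    ∫ s, T.toFun s x ∂(p ∗ q) = ∫ s, T.toFun s (∫ t, T.toFun t x ∂q) ∂p := by
  rw [integral_conv (T.integrable_orbit_measure _ x)]
  refine integral_congr_ae (ae_of_all _ fun s => ?_)
  simp only [T.map_add']
  exact (T.toFun s).integral_comp_comm (T.integrable_orbit_measure q x)

/-- The Hille-Phillips calculus is multiplicative. -/
theorem hpCalc_mul (T : BoundedC0Semigroup X) {f g : ℝ → ℂ} (hf : IsA1 f) (hg : IsA1 g) :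
    IsA1 (fun z => f z * g z) ∧
      ∀ x, T.hpCalc (fun z => f z * g z) x = T.hpCalc f (T.hpCalc g x) := by
  -- Both sides are bilinear in `f` and `g`, so a double induction reduces to scalar multiples of
  -- transforms of positive measures, where the product is a convolution.
  refine IsA1.induction (P := fun f => IsA1 f → IsA1 (fun z => f z * g z) ∧
      ∀ x, T.hpCalc (fun z => f z * g z) x = T.hpCalc f (T.hpCalc g x))
    (fun f₁ f₂ h ih h2 => ?_) (fun v p _ _ => ?_) (fun f₁ f₂ h1 h2 ih1 ih2 _ => ?_) hf hf
  · have h1 : IsA1 f₁ := by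
      obtain ⟨μ, hμ⟩ := h2
      exact ⟨μ, hμ.congr fun z hz => (h z hz).symm⟩
    obtain ⟨⟨μ, hμ⟩, e⟩ := ih h1
    have hc : ∀ z : ℝ, 0 < z → f₁ z * g z = f₂ z * g z := fun z hz => by rw [h z hz]
    exact ⟨⟨μ, hμ.congr hc⟩, fun x => by
      rw [← T.hpCalc_congr ⟨μ, hμ⟩ hc, e, T.hpCalc_congr h1 h]⟩
  · refine IsA1.induction (P := fun g => IsA1 g → IsA1 (fun z => v * laplace p z * g z) ∧
      ∀ x, T.hpCalc (fun z => v * laplace p z * g z) x =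
        T.hpCalc (fun z => v * laplace p z) (T.hpCalc g x))
      (fun g₁ g₂ h ih h2 => ?_) (fun w q _ _ => ?_) (fun g₁ g₂ h1 h2 ih1 ih2 _ => ?_) hg hg
    · have h1 : IsA1 g₁ := by
        obtain ⟨μ, hμ⟩ := h2
        exact ⟨μ, hμ.congr fun z hz => (h z hz).symm⟩
      obtain ⟨⟨μ, hμ⟩, e⟩ := ih h1
      have hc : ∀ z : ℝ, 0 < z → v * laplace p z * g₁ z = v * laplace p z * g₂ z :=
        fun z hz => by rw [h z hz]
      exact ⟨⟨μ, hμ.congr hc⟩, fun x => by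
        rw [← T.hpCalc_congr ⟨μ, hμ⟩ hc, e, T.hpCalc_congr h1 h]⟩
    · have hc : ∀ z : ℝ, 0 < z → (v * w) * (laplace (p ∗ q) z : ℂ) =
          v * laplace p z * (w * laplace q z) := fun z hz => by
        rw [laplace_conv p q hz.le]; push_cast; ring
      have hL := IsLaplaceOf.smulVector (p ∗ q) (v * w)
      refine ⟨⟨_, hL.congr hc⟩, fun x => ?_⟩
      rw [← T.hpCalc_congr ⟨_, hL⟩ hc, hpCalc_smul_laplace, hpCalc_smul_laplace,
        hpCalc_smul_laplace, integral_orbit_conv]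
      simp only [map_smul, integral_smul, mul_smul]
    · obtain ⟨i1, e1⟩ := ih1 h1
      obtain ⟨i2, e2⟩ := ih2 h2
      simp only [mul_add]
      refine ⟨?_, fun x => ?_⟩
      · obtain ⟨μ, hμ⟩ := i1
        obtain ⟨ν, hν⟩ := i2
        exact ⟨_, hμ.add hν⟩
      · rw [T.hpCalc_add i1 i2, T.hpCalc_add h1 h2, add_apply, add_apply, map_add, e1, e2]
  · obtain ⟨i1, e1⟩ := ih1 h1
    obtain ⟨i2, e2⟩ := ih2 h2
    simp only [add_mul]
    refine ⟨?_, fun x => ?_⟩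
    · obtain ⟨μ, hμ⟩ := i1
      obtain ⟨ν, hν⟩ := i2
      exact ⟨_, hμ.add hν⟩
    · rw [T.hpCalc_add i1 i2, T.hpCalc_add h1 h2, add_apply, add_apply, e1, e2]

end BoundedC0Semigroup

/-! ### Measures with density on the half-line -/

/-- The measure `k(u) du` on `[0, ∞)`. -/
def densityMeasure (k : ℝ → ℝ) : Measure ℝ≥0 :=
  (volume.withDensity fun u => ENNReal.ofReal (k u)).map Real.toNNReal

section densityMeasure

variable {k : ℝ → ℝ}

theorem isFiniteMeasure_densityMeasure (hk : Integrable k) : IsFiniteMeasure (densityMeasure k) := by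
  have := isFiniteMeasure_withDensity_ofReal hk.2
  unfold densityMeasure
  infer_instance

theorem integral_densityMeasure (hm : Measurable k) (h0 : ∀ u, 0 ≤ k u) {f : ℝ≥0 → ℝ}
    (hf : Measurable f) : ∫ s, f s ∂(densityMeasure k) = ∫ u, k u * f u.toNNReal := by
  rw [densityMeasure, integral_map measurable_real_toNNReal.aemeasurable hf.aestronglyMeasurable,
    integral_withDensity_eq_integral_toReal_smul hm.ennreal_ofReal (ae_of_all _ fun u =>
      ENNReal.ofReal_lt_top)]
  simp [ENNReal.toReal_ofReal (h0 _)]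

theorem real_univ_densityMeasure (hk : Integrable k) (hm : Measurable k) (h0 : ∀ u, 0 ≤ k u) :
    (densityMeasure k).real univ = ∫ u, k u := by
  have := isFiniteMeasure_densityMeasure hk
  have := integral_densityMeasure hm h0 (f := fun _ => 1) measurable_const
  simpa using this

/-- The density must vanish on the negative axis because `Real.toNNReal` collapses that axis to `0`.
-/
theorem laplace_densityMeasure (hm : Measurable k) (h0 : ∀ u, 0 ≤ k u) (hneg : ∀ u ≤ 0, k u = 0)
    (z : ℝ) : laplace (densityMeasure k) z = ∫ u, k u * Real.exp (-(z * u)) := by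
  rw [laplace, integral_densityMeasure hm h0 (by fun_prop)]
  refine integral_congr_ae (ae_of_all _ fun u => ?_)
  rcases le_or_gt u 0 with hu | hu
  · simp [hneg u hu]
  · simp [Real.coe_toNNReal _ hu.le]

end densityMeasure

/-! ### The kernel of `z ↦ (1 - e^{-rz}) z^{-α}` -/

/-- The function `u ↦ u ^ (α - 1)` on `(0, ∞)`, extended by zero. -/
def truncPow (α : ℝ) : ℝ → ℝ := (Ioi 0).indicator fun u => u ^ (α - 1)

/-- The positive part of `u ↦ truncPow α u - truncPow α (u - r)`. -/
def kernelPos (α r : ℝ) : ℝ → ℝ := (Ioc 0 r).indicator fun u => u ^ (α - 1)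

/-- The negative part of `u ↦ truncPow α u - truncPow α (u - r)`. -/
def kernelNeg (α r : ℝ) : ℝ → ℝ := (Ioi r).indicator fun u => (u - r) ^ (α - 1) - u ^ (α - 1)

section kernel

variable {α r : ℝ}

theorem kernelPos_sub_kernelNeg (hr : 0 < r) (u : ℝ) :
    kernelPos α r u - kernelNeg α r u = truncPow α u - truncPow α (u - r) := by
  unfold kernelPos kernelNeg truncPow
  rcases le_or_gt u 0 with h1 | h1
  · rw [indicator_of_notMem (by simp [h1]), indicator_of_notMem (by simp; linarith),
      indicator_of_notMem (by simpa using h1), indicator_of_notMem (by simp; linarith)]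
  · rcases le_or_gt u r with h2 | h2
    · rw [indicator_of_mem (show u ∈ Ioc 0 r from ⟨h1, h2⟩), indicator_of_notMem (by simpa using h2),
        indicator_of_mem (show u ∈ Ioi 0 from h1), indicator_of_notMem (by simpa using h2)]
    · rw [indicator_of_notMem (by simp [h2]), indicator_of_mem (show u ∈ Ioi r from h2),
        indicator_of_mem (show u ∈ Ioi 0 from h1), indicator_of_mem (by simpa using h2)]
      ring

theorem measurable_kernelPos : Measurable (kernelPos α r) :=
  Measurable.indicator (by fun_prop) measurableSet_Ioc

theorem measurable_kernelNeg : Measurable (kernelNeg α r) :=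
  Measurable.indicator (by fun_prop) measurableSet_Ioi

theorem kernelPos_nonneg (u : ℝ) : 0 ≤ kernelPos α r u :=
  indicator_nonneg (fun _ hu => Real.rpow_nonneg hu.1.le _) u

theorem kernelNeg_nonneg (hα : α < 1) (hr : 0 < r) (u : ℝ) : 0 ≤ kernelNeg α r u :=
  indicator_nonneg (fun u (hu : r < u) => sub_nonneg.2
    (Real.rpow_le_rpow_of_nonpos (sub_pos.2 hu) (by linarith) (by linarith))) u

theorem kernelPos_of_nonpos {u : ℝ} (hu : u ≤ 0) : kernelPos α r u = 0 :=
  indicator_of_notMem (fun h => absurd h.1 (not_lt.2 hu)) _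

theorem kernelNeg_of_nonpos (hr : 0 < r) {u : ℝ} (hu : u ≤ 0) : kernelNeg α r u = 0 :=
  indicator_of_notMem (fun h => absurd (mem_Ioi.1 h) (not_lt.2 (hu.trans hr.le))) _

theorem integrable_kernelPos (hα : 0 < α) (hr : 0 < r) :
    Integrable (kernelPos α r) ∧ ∫ u, kernelPos α r u = r ^ α / α := by
  have hi : IntervalIntegrable (fun u : ℝ => u ^ (α - 1)) volume 0 r :=
    intervalIntegral.intervalIntegrable_rpow' (by linarith)
  refine ⟨(integrable_indicator_iff measurableSet_Ioc).2
    ((intervalIntegrable_iff_integrableOn_Ioc_of_le hr.le).1 hi), ?_⟩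
  rw [kernelPos, integral_indicator measurableSet_Ioc, ← intervalIntegral.integral_of_le hr.le,
    integral_rpow (Or.inl (by linarith))]
  simp [Real.zero_rpow hα.ne']

/-- The function is an antiderivative of the negative kernel. Writing each power as `v · v^{α-1}`
shows `0 ≤ u^α - (u - r)^α ≤ r u^{α-1}`, which tends to `0`. -/
theorem tendsto_sub_rpow_sub_rpow (hα : 0 < α) (hα1 : α < 1) (hr : 0 < r) :
    Tendsto (fun u : ℝ => ((u - r) ^ α - u ^ α) / α) atTop (𝓝 0) := by
  have h1 : Tendsto (fun u : ℝ => r * u ^ (α - 1)) atTop (𝓝 0) := by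
    have := tendsto_rpow_neg_atTop (show 0 < 1 - α by linarith)
    simpa using this.const_mul r
  have h2 : Tendsto (fun u : ℝ => u ^ α - (u - r) ^ α) atTop (𝓝 0) := by
    refine squeeze_zero' ?_ ?_ h1
    · filter_upwards [eventually_gt_atTop r] with u hu
      exact sub_nonneg.2 (Real.rpow_le_rpow (by linarith) (by linarith) hα.le)
    · filter_upwards [eventually_gt_atTop r] with u hu
      have hu0 : 0 < u := hr.trans hu
      have hur : 0 < u - r := sub_pos.2 hu
      have e1 : u ^ α = u * u ^ (α - 1) := by
        rw [← Real.rpow_one_add' hu0.le (by linarith)]; ring_nf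
      have e2 : (u - r) ^ α = (u - r) * (u - r) ^ (α - 1) := by
        rw [← Real.rpow_one_add' hur.le (by linarith)]; ring_nf
      have e3 : u ^ (α - 1) ≤ (u - r) ^ (α - 1) :=
        Real.rpow_le_rpow_of_nonpos hur (by linarith) (by linarith)
      have := mul_le_mul_of_nonneg_left e3 hur.le
      rw [e1, e2]
      linarith
  simpa only [zero_div, neg_zero] using (h2.div_const α).neg.congr fun u => by ring

theorem integrable_kernelNeg (hα : 0 < α) (hα1 : α < 1) (hr : 0 < r) :
    Integrable (kernelNeg α r) ∧ ∫ u, kernelNeg α r u = r ^ α / α := by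
  have hc : ContinuousWithinAt (fun u : ℝ => ((u - r) ^ α - u ^ α) / α) (Ici r) r := by
    refine Continuous.continuousWithinAt ?_
    refine Continuous.div_const (Continuous.sub ?_ ?_) _
    · exact (continuous_id.sub continuous_const).rpow_const fun _ => Or.inr hα.le
    · exact continuous_id.rpow_const fun _ => Or.inr hα.le
  have hd : ∀ u ∈ Ioi r, HasDerivAt (fun u : ℝ => ((u - r) ^ α - u ^ α) / α)
      ((u - r) ^ (α - 1) - u ^ (α - 1)) u := fun u hu => by
    have hu' : r < u := hu
    have h1 : HasDerivAt (fun u : ℝ => (u - r) ^ α) (1 * α * (u - r) ^ (α - 1)) u :=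
      ((hasDerivAt_id u).sub_const r).rpow_const (Or.inl (sub_pos.2 hu').ne')
    have h2 : HasDerivAt (fun u : ℝ => u ^ α) (1 * α * u ^ (α - 1)) u :=
      (hasDerivAt_id u).rpow_const (Or.inl (hr.trans hu').ne')
    refine ((h1.fun_sub h2).div_const α).congr_deriv ?_
    field_simp
  have hp : ∀ u ∈ Ioi r, 0 ≤ (u - r) ^ (α - 1) - u ^ (α - 1) := fun u hu => by
    have := kernelNeg_nonneg hα1 hr u
    rwa [kernelNeg, indicator_of_mem hu] at this
  have hl := tendsto_sub_rpow_sub_rpow hα hα1 hr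
  refine ⟨(integrable_indicator_iff measurableSet_Ioi).2
    (integrableOn_Ioi_deriv_of_nonneg hc hd hp hl), ?_⟩
  rw [kernelNeg, integral_indicator measurableSet_Ioi,
    integral_Ioi_of_hasDerivAt_of_nonneg hc hd hp hl]
  simp [Real.zero_rpow hα.ne', neg_div]

theorem integrable_truncPow_mul_exp (hα : 0 < α) {z : ℝ} (hz : 0 < z) :
    Integrable (fun u => truncPow α u * Real.exp (-(z * u))) ∧
      ∫ u, truncPow α u * Real.exp (-(z * u)) = z ^ (-α) * Real.Gamma α := by
  have e : (fun u => truncPow α u * Real.exp (-(z * u))) =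
      (Ioi 0).indicator fun u => u ^ (α - 1) * Real.exp (-(z * u)) := by
    ext u
    by_cases hu : u ∈ Ioi (0 : ℝ) <;> simp [truncPow, hu]
  rw [e, integral_indicator measurableSet_Ioi, Real.integral_rpow_mul_exp_neg_mul_Ioi hα hz,
    integrable_indicator_iff measurableSet_Ioi]
  refine ⟨?_, ?_⟩
  · have := integrableOn_rpow_mul_exp_neg_mul_rpow (s := α - 1) (by linarith) zero_lt_one hz
    simpa using this
  · rw [one_div, Real.inv_rpow hz.le, Real.rpow_neg hz.le]

/-- The kernel is the truncated power minus its translate by `r`. Translation multiplies the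
transform by `e^{-zr}`, and the transform of the truncated power is a Gamma integral. -/
theorem integral_kernel_mul_exp (hα : 0 < α) (hα1 : α < 1) (hr : 0 < r) {z : ℝ} (hz : 0 < z) :
    (∫ u, kernelPos α r u * Real.exp (-(z * u))) - ∫ u, kernelNeg α r u * Real.exp (-(z * u)) =
      z ^ (-α) * (1 - Real.exp (-(z * r))) * Real.Gamma α := by
  have hb : ∀ k : ℝ → ℝ, Integrable k → (∀ u ≤ 0, k u = 0) →
      Integrable fun u => k u * Real.exp (-(z * u)) := fun k hk h0 => by
    refine hk.mono (hk.1.mul (by fun_prop)) (ae_of_all _ fun u => ?_)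
    rcases le_or_gt u 0 with hu | hu
    · simp [h0 u hu]
    · rw [norm_mul]
      refine mul_le_of_le_one_right (norm_nonneg _) ?_
      rw [Real.norm_eq_abs, Real.abs_exp, Real.exp_le_one_iff, neg_nonpos]
      positivity
  obtain ⟨hi, he⟩ := integrable_truncPow_mul_exp hα hz
  have hs : (fun u => truncPow α (u - r) * Real.exp (-(z * u))) = fun u =>
      Real.exp (-(z * r)) * (truncPow α (u - r) * Real.exp (-(z * (u - r)))) := by
    ext u
    rw [mul_left_comm, ← Real.exp_add]
    ring_nf
  have hi' : Integrable fun u => truncPow α (u - r) * Real.exp (-(z * u)) := by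
    rw [hs]
    exact (hi.comp_sub_right r).const_mul _
  rw [← integral_sub (hb _ (integrable_kernelPos hα hr).1 fun u hu => kernelPos_of_nonpos hu)
    (hb _ (integrable_kernelNeg hα hα1 hr).1 fun u hu => kernelNeg_of_nonpos hr hu)]
  simp only [← sub_mul, kernelPos_sub_kernelNeg hr]
  simp only [sub_mul]
  rw [integral_sub hi hi', hs, integral_const_mul,
    integral_sub_right_eq_self (fun u => truncPow α u * Real.exp (-(z * u))) r, he]
  ring

end kernel

/-- The midpoint of `1 + α` and `3 - α` is `2`, and `Γ(2) = 1`, so log-convexity gives `Γ(1 + α) Γ(3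
- α) ≥ 1`. Convexity on `[2, 3]` gives `Γ(3 - α) ≤ 2`. -/
theorem half_le_Gamma_one_add {α : ℝ} (h0 : 0 < α) (h1 : α < 1) : 1 / 2 ≤ Real.Gamma (1 + α) := by
  have hpos : 0 < Real.Gamma (1 + α) := Real.Gamma_pos_of_pos (by linarith)
  have hpos' : 0 < Real.Gamma (3 - α) := Real.Gamma_pos_of_pos (by linarith)
  have hG2 : Real.Gamma 2 = 1 := Real.Gamma_two
  have hG3 : Real.Gamma 3 = 2 := by
    rw [show (3 : ℝ) = 2 + 1 by norm_num, Real.Gamma_add_one two_ne_zero, hG2]; norm_num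
  have h3 : Real.Gamma (3 - α) ≤ 2 := by
    have := Real.convexOn_Gamma.2 (show (2 : ℝ) ∈ Ioi 0 by simp) (show (3 : ℝ) ∈ Ioi 0 by simp)
      h0.le (show 0 ≤ 1 - α by linarith) (by ring)
    simp only [smul_eq_mul, hG2, hG3] at this
    rw [show α * 2 + (1 - α) * 3 = 3 - α by ring] at this
    linarith
  have hl := Real.convexOn_log_Gamma.2 (show 1 + α ∈ Ioi (0 : ℝ) by simp; linarith)
    (show 3 - α ∈ Ioi (0 : ℝ) by simp; linarith) (show (0 : ℝ) ≤ 1 / 2 by norm_num)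
    (show (0 : ℝ) ≤ 1 / 2 by norm_num) (by norm_num)
  simp only [smul_eq_mul, Function.comp_apply] at hl
  rw [show 1 / 2 * (1 + α) + 1 / 2 * (3 - α) = 2 by ring, hG2, Real.log_one] at hl
  have h4 : 0 ≤ Real.log (Real.Gamma (1 + α) * Real.Gamma (3 - α)) := by
    rw [Real.log_mul hpos.ne' hpos'.ne']; linarith
  have h5 : 1 ≤ Real.Gamma (1 + α) * Real.Gamma (3 - α) := by
    by_contra h
    exact absurd (Real.log_neg (mul_pos hpos hpos') (not_le.1 h)) (not_lt.2 h4)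
  nlinarith

/-- The measures have the two kernels divided by `Γ(α)` as densities. Each has mass `r^α / (α Γ(α))
= r^α / Γ(1 + α)`, whence the factor `2`. -/
theorem exists_measures_laplace_sub_eq {α r : ℝ} (hα : 0 < α) (hα1 : α < 1) (hr : 0 < r) :
    ∃ (p q : Measure ℝ≥0) (_ : IsFiniteMeasure p) (_ : IsFiniteMeasure q),
      p.real univ ≤ 2 * r ^ α ∧ q.real univ ≤ 2 * r ^ α ∧ ∀ z : ℝ, 0 < z →
        laplace p z - laplace q z = z ^ (-α) * (1 - Real.exp (-(z * r))) := by
  have hG : 0 < Real.Gamma α := Real.Gamma_pos_of_pos hα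
  set c : ℝ := (Real.Gamma α)⁻¹ with hc
  have hc0 : 0 < c := inv_pos.2 hG
  have hmass : c * (r ^ α / α) ≤ 2 * r ^ α := by
    have h1 := half_le_Gamma_one_add hα hα1
    rw [add_comm, Real.Gamma_add_one hα.ne'] at h1
    have hpos : 0 < α * Real.Gamma α := mul_pos hα hG
    have e : c * (r ^ α / α) = r ^ α / (α * Real.Gamma α) := by rw [hc]; field_simp
    rw [e, div_le_iff₀ hpos]
    nlinarith [Real.rpow_pos_of_pos hr α]
  obtain ⟨ip, mp⟩ := integrable_kernelPos hα hr
  obtain ⟨iq, mq⟩ := integrable_kernelNeg hα hα1 hr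
  have zp : ∀ u, 0 ≤ c * kernelPos α r u := fun u => mul_nonneg hc0.le (kernelPos_nonneg u)
  have zq : ∀ u, 0 ≤ c * kernelNeg α r u := fun u => mul_nonneg hc0.le (kernelNeg_nonneg hα1 hr u)
  have mep : Measurable fun u => c * kernelPos α r u := measurable_kernelPos.const_mul c
  have meq : Measurable fun u => c * kernelNeg α r u := measurable_kernelNeg.const_mul c
  refine ⟨densityMeasure fun u => c * kernelPos α r u, densityMeasure fun u => c * kernelNeg α r u,
    isFiniteMeasure_densityMeasure (ip.const_mul c),
    isFiniteMeasure_densityMeasure (iq.const_mul c), ?_, ?_, fun z hz => ?_⟩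
  · rwa [real_univ_densityMeasure (ip.const_mul c) mep zp, integral_const_mul, mp]
  · rwa [real_univ_densityMeasure (iq.const_mul c) meq zq, integral_const_mul, mq]
  · rw [laplace_densityMeasure mep zp fun u hu => by rw [kernelPos_of_nonpos hu, mul_zero],
      laplace_densityMeasure meq zq fun u hu => by rw [kernelNeg_of_nonpos hr hu, mul_zero]]
    simp only [mul_assoc]
    rw [integral_const_mul, integral_const_mul, ← mul_sub,
      integral_kernel_mul_exp hα hα1 hr hz, hc]
    field_simp

/-! ### Hölder continuity of orbits -/

namespace BoundedC0Semigroup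

variable {X : Type*} [NormedAddCommGroup X] [NormedSpace ℂ X]

theorem tendsto_negGenerator (T : BoundedC0Semigroup X) (x : T.negGenerator.domain) :
    Tendsto (fun h : ℝ≥0 => ((h : ℝ) : ℂ)⁻¹ • ((x : X) - T.toFun h x)) (𝓝[>] 0)
      (𝓝 (T.negGenerator x)) :=
  x.2.choose_spec

/-- A right derivative is immediate from the semigroup law and is all that the mean value inequality
for orbits needs. -/
theorem hasDerivWithinAt_orbit (T : BoundedC0Semigroup X) (x : T.negGenerator.domain) {t : ℝ}
    (ht : 0 ≤ t) : HasDerivWithinAt (fun s : ℝ => T.toFun s.toNNReal x)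
      (-T.toFun t.toNNReal (T.negGenerator x)) (Ici t) t := by
  rw [hasDerivWithinAt_iff_tendsto_slope, Ici_sdiff_left]
  have h1 : Tendsto (fun s : ℝ => (s - t).toNNReal) (𝓝[>] t) (𝓝[>] 0) := by
    refine tendsto_nhdsWithin_iff.2 ⟨?_, ?_⟩
    · have : Continuous fun s : ℝ => (s - t).toNNReal := by fun_prop
      have h := this.tendsto t
      simp only [sub_self, Real.toNNReal_zero] at h
      exact h.mono_left nhdsWithin_le_nhds
    · filter_upwards [self_mem_nhdsWithin] with s hs
      simpa using hs
  have h2 := (((T.toFun t.toNNReal).continuous.tendsto _).comp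
    ((T.tendsto_negGenerator x).comp h1)).neg
  refine h2.congr' ?_
  filter_upwards [self_mem_nhdsWithin] with s hs
  have hst : 0 < s - t := sub_pos.2 hs
  have e : s.toNNReal = t.toNNReal + (s - t).toNNReal := by
    rw [← Real.toNNReal_add ht hst.le]; congr 1; ring
  simp only [Function.comp_apply, slope, vsub_eq_sub, Real.coe_toNNReal _ hst.le]
  rw [e, T.map_add', ContinuousLinearMap.comp_apply, map_smul, map_sub, ← smul_neg, neg_sub,
    ← Complex.ofReal_inv, Complex.coe_smul]

theorem norm_orbit_sub_le (T : BoundedC0Semigroup X) (x : T.negGenerator.domain) (s t : ℝ≥0) :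
    ‖T.toFun s x - T.toFun t x‖ ≤ T.bound * ‖T.negGenerator x‖ * |(s : ℝ) - t| := by
  wlog hst : t ≤ s generalizing s t
  · rw [norm_sub_rev, abs_sub_comm]
    exact this t s (le_of_not_ge hst)
  have hst' : (t : ℝ) ≤ s := hst
  have := norm_image_sub_le_of_norm_deriv_right_le_segment (a := (t : ℝ)) (b := s)
    (f := fun s : ℝ => T.toFun s.toNNReal (x : X))
    (f' := fun s : ℝ => -T.toFun s.toNNReal (T.negGenerator x))
    (C := T.bound * ‖T.negGenerator x‖)
    ((T.continuous' x).comp continuous_real_toNNReal).continuousOn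
    (fun u hu => T.hasDerivWithinAt_orbit x (t.2.trans hu.1))
    (fun u hu => by rw [norm_neg]; exact T.norm_apply_le _ _) s ⟨hst', le_rfl⟩
  simpa [abs_of_nonneg (sub_nonneg.2 hst')] using this

variable [CompleteSpace X]

/-- All that is used about the extended calculus. The first alternative covers a function without
regularizer, where the domain is `{0}`. -/
theorem extCalc_spec (T : BoundedC0Semigroup X) (f : ℝ → ℂ) (x : (T.extCalc f).domain) :
    (x : X) = 0 ∨ ∃ e, T.IsRegularizer f e ∧
      T.hpCalc e (T.extCalc f x) = T.hpCalc (fun z => e z * f z) x := by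
  -- The type of `x` depends on the operator, so the operator is generalized before the case split.
  suffices H : ∀ L : X →ₗ.[ℂ] X, L = T.extCalc f → ∀ x : L.domain, (x : X) = 0 ∨
      ∃ e, T.IsRegularizer f e ∧ T.hpCalc e (L x) = T.hpCalc (fun z => e z * f z) x from H _ rfl x
  intro L hL
  unfold extCalc at hL
  split_ifs at hL with h
  · subst hL
    intro x
    refine Or.inr ⟨h.choose, h.choose_spec, ?_⟩
    exact congrArg Subtype.val ((LinearEquiv.ofInjective
      (T.hpCalc h.choose : X →ₗ[ℂ] X) h.choose_spec.2.2).apply_symm_apply _)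
  · subst hL
    intro x
    exact Or.inl ((Submodule.mem_bot ℂ).1 x.2)

/-- On the domain of `A^α`, the increments of an orbit are given by an integral kernel. -/
theorem sub_orbit_eq_of_mem_fracPow (T : BoundedC0Semigroup X) {α : ℝ} (x : (T.fracPow α).domain)
    {r : ℝ≥0} {p q : Measure ℝ≥0} [IsFiniteMeasure p] [IsFiniteMeasure q]
    (hpq : ∀ z : ℝ, 0 < z →
      laplace p z - laplace q z = z ^ (-α) * (1 - Real.exp (-(z * r)))) :
    (x : X) - T.toFun r x =
      ∫ s, T.toFun s (T.fracPow α x) ∂p - ∫ s, T.toFun s (T.fracPow α x) ∂q := by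
  rcases T.extCalc_spec _ x with hx | ⟨e, ⟨he, hef, hinj⟩, hy⟩
  · have h0 : x = 0 := Subtype.ext hx
    subst h0
    simp
  obtain ⟨hφ, hφx⟩ := T.hpCalc_laplace_sub p q
    (f := fun z => (laplace p z : ℂ) - laplace q z) fun z _ => rfl
  obtain ⟨hψ, hψx⟩ := T.hpCalc_laplace_sub (Measure.dirac 0) (Measure.dirac r)
    (f := fun z => (laplace (Measure.dirac 0) z : ℂ) - laplace (Measure.dirac r) z) fun z _ => rfl
  rw [← hφx]
  have h1 : (x : X) - T.toFun r x = T.hpCalc (fun z => (laplace (Measure.dirac 0) z : ℂ) -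
      laplace (Measure.dirac r) z) x := by
    rw [hψx, integral_dirac, integral_dirac, T.map_zero']; rfl
  rw [h1]
  -- After applying the injective `e(A)`, the claim is the identity `(1 - e^{-rz}) e = z^{-α}(1 -
  -- e^{-rz}) · (e z^α)` inside the algebra.
  refine hinj ?_
  rw [← (T.hpCalc_mul he hψ).2, ← (T.hpCalc_mul he hφ).2]
  simp only [mul_comm (e _)]
  rw [(T.hpCalc_mul hφ he).2]
  change _ = T.hpCalc _ (T.hpCalc e (T.extCalc _ x))
  rw [hy, ← (T.hpCalc_mul hφ hef).2]
  refine congrFun (congrArg _ (T.hpCalc_congr (T.hpCalc_mul hψ he).1 fun z hz => ?_)) _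
  have e1 : ((laplace p z : ℂ) - laplace q z) = ((z ^ (-α) * (1 - Real.exp (-(z * r))) : ℝ) : ℂ) := by
    rw [← hpq z hz]; push_cast; rfl
  have e2 : ((z ^ (-α) : ℝ) : ℂ) * ((z ^ α : ℝ) : ℂ) = 1 := by
    rw [← Complex.ofReal_mul, ← Real.rpow_add hz]; simp
  rw [e1, laplace_dirac, laplace_dirac]
  simp only [NNReal.coe_zero, mul_zero, neg_zero, Real.exp_zero, Complex.ofReal_mul,
    Complex.ofReal_sub, Complex.ofReal_one]
  linear_combination (-(1 - (Real.exp (-(z * r)) : ℂ)) * e z) * e2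

/-- Factor out `e^{-sA}` and use the kernel representation of `x - e^{-rA}x`; two measures of mass
at most `2r^α` give the `4`. -/
theorem norm_orbit_sub_le_fracPow (T : BoundedC0Semigroup X) {α : ℝ} (hα : 0 < α) (hα1 : α < 1)
    (x : (T.fracPow α).domain) (s t : ℝ≥0) :
    ‖T.toFun s x - T.toFun t x‖ ≤ 4 * T.bound * ‖T.fracPow α x‖ * |(s : ℝ) - t| ^ α := by
  wlog hst : s ≤ t generalizing s t
  · rw [norm_sub_rev, abs_sub_comm]
    exact this t s (le_of_not_ge hst)
  rcases hst.eq_or_lt with rfl | hlt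
  · simp [Real.zero_rpow hα.ne']
  obtain ⟨r, rfl⟩ := le_iff_exists_add.1 hst
  have hr : (0 : ℝ) < r := by
    rcases eq_or_ne r 0 with rfl | h
    · simp at hlt
    · exact NNReal.coe_pos.2 (pos_iff_ne_zero.2 h)
  obtain ⟨p, q, hp, hq, mp, mq, hpq⟩ := exists_measures_laplace_sub_eq hα hα1 hr
  have e : T.toFun s x - T.toFun (s + r) x =
      T.toFun s ((x : X) - T.toFun r x) := by
    rw [map_sub, T.map_add', ContinuousLinearMap.comp_apply]
  set y := T.fracPow α x
  have hb : ∀ m : Measure ℝ≥0, IsFiniteMeasure m → m.real univ ≤ 2 * (r : ℝ) ^ α →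
      ‖T.toFun s (∫ u, T.toFun u y ∂m)‖ ≤ T.bound * ‖y‖ * (2 * (r : ℝ) ^ α) := fun m hm hle => by
    -- Moving `e^{-sA}` inside the integral merges it with `e^{-uA}`, so the bound contains `M` and
    -- not `M²`.
    rw [← (T.toFun s).integral_comp_comm (T.integrable_orbit_measure m y)]
    refine (norm_integral_le_of_norm_le_const (C := T.bound * ‖y‖) (ae_of_all _ fun u => ?_)).trans
      (mul_le_mul_of_nonneg_left hle (mul_nonneg T.bound_nonneg (norm_nonneg _)))
    rw [← ContinuousLinearMap.comp_apply, ← T.map_add']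
    exact T.norm_apply_le _ _
  rw [e, T.sub_orbit_eq_of_mem_fracPow x hpq, map_sub]
  refine (norm_sub_le _ _).trans ((add_le_add (hb p hp mp) (hb q hq mq)).trans (le_of_eq ?_))
  have : |(s : ℝ) - ((s + r : ℝ≥0) : ℝ)| = r := by
    rw [NNReal.coe_add, sub_add_cancel_left, abs_neg, abs_of_pos hr]
  rw [this]
  ring

end BoundedC0Semigroup

/-! ### Moments of the representing measure -/

/-- Monotone convergence along `z = 1/(n + 1)`. Neither finiteness of `ν` nor integrability of `φ`
is presupposed, so total mass and mean follow for whichever representing measure was chosen. -/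
theorem lintegral_eq_of_tendsto_laplace {ν : Measure ℝ≥0} {φ : ℝ≥0 → ℝ} (hφ : Measurable φ)
    (h0 : ∀ s, 0 ≤ φ s)
    (hi : ∀ z : ℝ, 0 < z → Integrable (fun s : ℝ≥0 => φ s * Real.exp (-(z * s))) ν) {c : ℝ}
    (hc : Tendsto (fun z : ℝ => ∫ s : ℝ≥0, φ s * Real.exp (-(z * s)) ∂ν) (𝓝[>] 0) (𝓝 c)) :
    ∫⁻ s, ENNReal.ofReal (φ s) ∂ν = ENNReal.ofReal c := by
  have hu : Tendsto (fun n : ℕ => (1 : ℝ) / (n + 1)) atTop (𝓝[>] 0) :=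
    tendsto_nhdsWithin_iff.2 ⟨tendsto_one_div_add_atTop_nhds_zero_nat,
      Eventually.of_forall fun n => by simp only [mem_Ioi]; positivity⟩
  have h1 : Tendsto (fun n : ℕ => ∫⁻ s : ℝ≥0,
      ENNReal.ofReal (φ s * Real.exp (-(1 / ((n : ℝ) + 1) * s))) ∂ν) atTop
      (𝓝 (∫⁻ s, ENNReal.ofReal (φ s) ∂ν)) := by
    refine lintegral_tendsto_of_tendsto_of_monotone
      (fun n => by fun_prop) (ae_of_all _ fun s => ?_)
      (ae_of_all _ fun s => ?_)
    · intro m n hmn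
      refine ENNReal.ofReal_le_ofReal (mul_le_mul_of_nonneg_left (Real.exp_le_exp.2 ?_) (h0 s))
      refine neg_le_neg (mul_le_mul_of_nonneg_right ?_ s.2)
      have : (m : ℝ) ≤ n := by exact_mod_cast hmn
      exact one_div_le_one_div_of_le (by positivity) (by linarith)
    · have hcont : Continuous fun z : ℝ => ENNReal.ofReal (φ s * Real.exp (-(z * s))) :=
        ENNReal.continuous_ofReal.comp (by fun_prop)
      have h := hcont.tendsto 0
      simp only [zero_mul, neg_zero, Real.exp_zero, mul_one] at h
      exact (h.mono_left nhdsWithin_le_nhds).comp hu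
  refine tendsto_nhds_unique h1 ?_
  refine (ENNReal.tendsto_ofReal (hc.comp hu)).congr fun n => ?_
  exact ofReal_integral_eq_lintegral_ofReal (hi _ (by positivity))
    (ae_of_all _ fun s => mul_nonneg (h0 s) (Real.exp_pos _).le)

/-- On the positive axis `g(z)` is the moment generating function of the identity at `-z`, which
lies in the interior of its domain of finiteness. -/
theorem IsRepresentedBy.hasDerivAt {g : ℝ → ℝ} {ν : Measure ℝ≥0} (h : IsRepresentedBy g ν) {z : ℝ}
    (hz : 0 < z) : Integrable (fun s : ℝ≥0 => (s : ℝ) * Real.exp (-(z * s))) ν ∧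
      HasDerivAt g (-∫ s : ℝ≥0, (s : ℝ) * Real.exp (-(z * s)) ∂ν) z := by
  have hset : Iio 0 ⊆ ProbabilityTheory.integrableExpSet (fun s : ℝ≥0 => (s : ℝ)) ν := fun t ht => by
    have := (h (-t) (neg_pos.2 ht)).1
    simpa [ProbabilityTheory.integrableExpSet] using this
  have hmem : -z ∈ interior (ProbabilityTheory.integrableExpSet (fun s : ℝ≥0 => (s : ℝ)) ν) :=
    interior_maximal hset isOpen_Iio (neg_lt_zero.2 hz)
  have h1 := ProbabilityTheory.integrable_pow_mul_exp_of_mem_interior_integrableExpSet hmem 1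
  have h2 := ProbabilityTheory.hasDerivAt_mgf hmem
  simp only [pow_one, neg_mul] at h1 h2
  refine ⟨h1, ?_⟩
  have h3 := h2.comp z (hasDerivAt_neg z)
  rw [mul_neg_one] at h3
  refine h3.congr_of_eventuallyEq ?_
  filter_upwards [Ioi_mem_nhds hz] with y hy
  rw [(h y hy).2]
  simp [ProbabilityTheory.mgf]

namespace IsB1

variable {g : ℝ → ℝ}

theorem isRepresentedBy (hg : IsB1 g) : IsRepresentedBy g (bernsteinMeasure g) := by
  obtain ⟨ν, -, hν⟩ := hg.exists_isRepresentedBy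
  have h : ∃ ν, IsRepresentedBy g ν := ⟨ν, hν⟩
  rw [bernsteinMeasure, dif_pos h]
  exact h.choose_spec

theorem isProbabilityMeasure (hg : IsB1 g) : IsProbabilityMeasure (bernsteinMeasure g) := by
  have hr := hg.isRepresentedBy
  have h := lintegral_eq_of_tendsto_laplace (ν := bernsteinMeasure g) (φ := fun _ => 1) (c := 1)
    measurable_const (fun _ => zero_le_one) (fun z hz => by simpa using (hr z hz).1)
    (hg.value_zero.congr' (by
      filter_upwards [self_mem_nhdsWithin] with z hz
      simpa using (hr z hz).2))
  exact ⟨by simpa using h⟩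

theorem deriv_eq (hg : IsB1 g) {z : ℝ} (hz : 0 < z) :
    deriv g z = -∫ s : ℝ≥0, (s : ℝ) * Real.exp (-(z * s)) ∂(bernsteinMeasure g) :=
  (hg.isRepresentedBy.hasDerivAt hz).2.deriv

theorem laplace_eq (hg : IsB1 g) {z : ℝ} (hz : 0 < z) : g z = laplace (bernsteinMeasure g) z :=
  (hg.isRepresentedBy z hz).2

theorem lintegral_id (hg : IsB1 g) :
    ∫⁻ s : ℝ≥0, ENNReal.ofReal (s : ℝ) ∂(bernsteinMeasure g) = 1 := by
  have h := lintegral_eq_of_tendsto_laplace (ν := bernsteinMeasure g) (φ := fun s => (s : ℝ))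
    (c := 1) (by fun_prop) (fun s => s.2) (fun z hz => (hg.isRepresentedBy.hasDerivAt hz).1) (by
      have := hg.deriv_zero.neg
      rw [neg_neg] at this
      refine this.congr' ?_
      filter_upwards [self_mem_nhdsWithin] with z hz
      rw [hg.deriv_eq hz, neg_neg])
  simpa using h

theorem integrable_id (hg : IsB1 g) : Integrable (fun s : ℝ≥0 => (s : ℝ)) (bernsteinMeasure g) := by
  refine ⟨by fun_prop, ?_⟩
  rw [hasFiniteIntegral_iff_ofReal (ae_of_all _ fun s => s.2), hg.lintegral_id]
  exact ENNReal.one_lt_top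

theorem integral_id (hg : IsB1 g) : ∫ s : ℝ≥0, (s : ℝ) ∂(bernsteinMeasure g) = 1 := by
  rw [integral_eq_lintegral_of_nonneg_ae (ae_of_all _ fun s => s.2) (by fun_prop), hg.lintegral_id]
  rfl

theorem _root_.functionalL_nonneg (g : ℝ → ℝ) : 0 ≤ functionalL g :=
  setIntegral_nonneg measurableSet_Icc fun s hs => sub_nonneg.2 (by exact_mod_cast hs.2)

theorem integral_abs_sub_one (hg : IsB1 g) :
    ∫ s : ℝ≥0, |(s : ℝ) - 1| ∂(bernsteinMeasure g) = 2 * functionalL g := by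
  have := hg.isProbabilityMeasure
  have hi : Integrable (fun s : ℝ≥0 => (s : ℝ) - 1) (bernsteinMeasure g) :=
    hg.integrable_id.sub (integrable_const 1)
  have hi' : Integrable ((Icc (0 : ℝ≥0) 1).indicator fun s => 1 - (s : ℝ)) (bernsteinMeasure g) :=
    ((integrable_const (1 : ℝ)).sub hg.integrable_id).indicator measurableSet_Icc
  -- The term `s - 1` integrates to zero because the mean is `1`, leaving twice the integral that
  -- defines `L[g]`.
  have e : ∀ s : ℝ≥0, |(s : ℝ) - 1| =
      ((s : ℝ) - 1) + 2 * (Icc (0 : ℝ≥0) 1).indicator (fun s => 1 - (s : ℝ)) s := fun s => by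
    by_cases hs : s ∈ Icc (0 : ℝ≥0) 1
    · have : (s : ℝ) ≤ 1 := by exact_mod_cast hs.2
      rw [indicator_of_mem hs, abs_of_nonpos (by linarith)]; ring
    · have h1 : 1 < s := not_le.1 fun h => hs ⟨zero_le, h⟩
      have : (1 : ℝ) < s := by exact_mod_cast h1
      rw [indicator_of_notMem hs, abs_of_nonneg (by linarith)]; ring
  simp only [e]
  rw [integral_add hi (hi'.const_mul 2), integral_const_mul, integral_indicator measurableSet_Icc,
    integral_sub hg.integrable_id (integrable_const 1), hg.integral_id, functionalL]
  simp

/-- `1 + g'(z)` as an integral. -/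
theorem one_add_deriv_eq (hg : IsB1 g) {z : ℝ} (hz : 0 < z) :
    Integrable (fun s : ℝ≥0 => (s : ℝ) * (1 - Real.exp (-(z * s)))) (bernsteinMeasure g) ∧
      1 + deriv g z = ∫ s : ℝ≥0, (s : ℝ) * (1 - Real.exp (-(z * s))) ∂(bernsteinMeasure g) := by
  have h1 := (hg.isRepresentedBy.hasDerivAt hz).1
  simp only [mul_sub, mul_one]
  refine ⟨hg.integrable_id.sub h1, ?_⟩
  rw [integral_sub hg.integrable_id h1, hg.integral_id, hg.deriv_eq hz]
  ring

theorem one_add_deriv_mem (hg : IsB1 g) {z : ℝ} (hz : 0 < z) : 1 + deriv g z ∈ Icc (0 : ℝ) 1 := by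
  constructor
  · rw [(hg.one_add_deriv_eq hz).2]
    refine integral_nonneg fun s => mul_nonneg s.2 (sub_nonneg.2 ?_)
    rw [Real.exp_le_one_iff, neg_nonpos]
    positivity
  · rw [hg.deriv_eq hz]
    have : 0 ≤ ∫ s : ℝ≥0, (s : ℝ) * Real.exp (-(z * s)) ∂(bernsteinMeasure g) :=
      integral_nonneg fun s => mul_nonneg s.2 (Real.exp_pos _).le
    linarith

end IsB1

/-! ### Averages of independent random variables -/

section Average

open ProbabilityTheory

variable {Ω : Type*} [MeasurableSpace Ω] (ν : Measure Ω) [IsProbabilityMeasure ν]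

theorem integral_pi_eval {n : ℕ} {φ : Ω → ℝ} (hφ : Integrable φ ν) (i : Fin n) :
    Integrable (fun w : Fin n → Ω => φ (w i)) (Measure.pi fun _ => ν) ∧
      ∫ w : Fin n → Ω, φ (w i) ∂(Measure.pi fun _ => ν) = ∫ a, φ a ∂ν := by
  have hmp := measurePreserving_eval (fun _ : Fin n => ν) i
  refine ⟨hmp.integrable_comp_of_integrable hφ, ?_⟩
  conv_rhs => rw [← hmp.map_eq]
  rw [integral_map hmp.measurable.aemeasurable (by rw [hmp.map_eq]; exact hφ.1)]

theorem integrable_average {n : ℕ} {φ : Ω → ℝ} (hφ : Integrable φ ν) (c : ℝ) :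
    Integrable (fun w : Fin n → Ω => (∑ i, φ (w i)) / n - c) (Measure.pi fun _ => ν) :=
  ((integrable_finsetSum _ fun i _ => (integral_pi_eval ν hφ i).1).div_const _).sub
    (integrable_const c)

/-- Triangle inequality without cancellation; meant for the tail part, whose first moment is already
small. -/
theorem integral_abs_average_sub_le {n : ℕ} (hn : 0 < n) {φ : Ω → ℝ} (hφ : Integrable φ ν) :
    ∫ w : Fin n → Ω, |(∑ i, φ (w i)) / n - ∫ a, φ a ∂ν| ∂(Measure.pi fun _ => ν) ≤
      2 * ∫ a, |φ a| ∂ν := by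
  have hn' : (n : ℝ) ≠ 0 := by exact_mod_cast hn.ne'
  have hI : Integrable (fun w : Fin n → Ω => (∑ i, |φ (w i)|) / n) (Measure.pi fun _ => ν) :=
    (integrable_finsetSum _ fun i _ => (integral_pi_eval ν hφ.abs i).1).div_const _
  calc _ ≤ ∫ w : Fin n → Ω, ((∑ i, |φ (w i)|) / n + ∫ a, |φ a| ∂ν) ∂(Measure.pi fun _ => ν) := by
        refine integral_mono (integrable_average ν hφ _).abs (hI.add (integrable_const _))
          fun w => ?_
        refine (abs_sub _ _).trans (add_le_add ?_ (abs_integral_le_integral_abs))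
        rw [abs_div, Nat.abs_cast]
        exact div_le_div_of_nonneg_right (Finset.abs_sum_le_sum_abs _ _) (Nat.cast_nonneg n)
    _ = 2 * ∫ a, |φ a| ∂ν := by
        rw [integral_add hI (integrable_const _), integral_div,
          integral_finsetSum _ fun i _ => (integral_pi_eval ν hφ.abs i).1]
        simp only [(integral_pi_eval ν hφ.abs _).2]
        simp
        field_simp
        ring

/-- Independence makes variances add, and Cauchy–Schwarz passes from the second moment to the first.
-/
theorem integral_abs_average_sub_le_sqrt {n : ℕ} (hn : 0 < n) {φ : Ω → ℝ} (hφ : MemLp φ 2 ν) :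
    ∫ w : Fin n → Ω, |(∑ i, φ (w i)) / n - ∫ a, φ a ∂ν| ∂(Measure.pi fun _ => ν) ≤
      √((∫ a, φ a ^ 2 ∂ν) / n) := by
  have hn' : (n : ℝ) ≠ 0 := by exact_mod_cast hn.ne'
  have hφ1 : Integrable φ ν := hφ.integrable one_le_two
  set π : Measure (Fin n → Ω) := Measure.pi fun _ => ν with hπ
  set S : (Fin n → Ω) → ℝ := ∑ i, fun w => φ (w i) with hS
  have hSw : ∀ w, S w = ∑ i, φ (w i) := fun w => by rw [hS, Finset.sum_apply]
  have hSm : MemLp S 2 π := memLp_finsetSum' _ fun i _ =>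
    hφ.comp_measurePreserving (measurePreserving_eval _ i)
  have hES : ∫ w, S w ∂π = n * ∫ a, φ a ∂ν := by
    simp only [hSw]
    rw [integral_finsetSum _ fun i _ => (integral_pi_eval ν hφ1 i).1]
    simp only [(integral_pi_eval ν hφ1 _).2]
    simp
  have hVar : Var[S; π] ≤ n * ∫ a, φ a ^ 2 ∂ν := by
    rw [hS, hπ, variance_sum_pi fun _ => hφ, Finset.sum_const, Finset.card_univ, Fintype.card_fin,
      nsmul_eq_mul]
    exact mul_le_mul_of_nonneg_left (variance_le_expectation_sq hφ.1) (Nat.cast_nonneg n)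
  rw [variance_eq_integral hSm.1.aemeasurable, hES] at hVar
  have hD : MemLp (fun w => S w - n * ∫ a, φ a ∂ν) 2 π := hSm.sub (memLp_const _)
  refine Real.le_sqrt_of_sq_le ?_
  have e : ∀ w : Fin n → Ω, |(∑ i, φ (w i)) / n - ∫ a, φ a ∂ν| =
      |S w - n * ∫ a, φ a ∂ν| / n := fun w => by
    rw [← hSw, ← Nat.abs_cast n, ← abs_div, Nat.abs_cast]
    congr 1
    field_simp
  simp only [e]
  rw [integral_div]
  have hcs : (∫ w, |S w - n * ∫ a, φ a ∂ν| ∂π) ^ 2 ≤ ∫ w, (S w - n * ∫ a, φ a ∂ν) ^ 2 ∂π := by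
    -- Cauchy–Schwarz in the form that the variance of the absolute deviation is nonnegative.
    have h1 : 0 ≤ Var[fun w => |S w - n * ∫ a, φ a ∂ν|; π] := variance_nonneg _ _
    have hDa : MemLp (fun w => |S w - n * ∫ a, φ a ∂ν|) 2 π := hD.abs
    rw [variance_eq_sub hDa] at h1
    simpa using h1
  rw [div_pow, div_le_div_iff₀ (by positivity) (by positivity)]
  calc _ ≤ (n * ∫ a, φ a ^ 2 ∂ν) * n :=
        mul_le_mul_of_nonneg_right (hcs.trans hVar) (Nat.cast_nonneg n)
    _ = _ := by ring

end Average

/-! ### Deviation of averages from the mean -/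

theorem exp_neg_le_one_sub_half {x : ℝ} (h0 : 0 ≤ x) (h1 : x ≤ 1) : Real.exp (-x) ≤ 1 - x / 2 := by
  have h2 : (1 + x) * Real.exp (-x) ≤ 1 := by
    have := mul_le_mul_of_nonneg_right (Real.add_one_le_exp x) (Real.exp_pos (-x)).le
    rw [← Real.exp_add, add_neg_cancel, Real.exp_zero] at this
    linarith
  have h3 := Real.exp_pos (-x)
  nlinarith

theorem exp_neg_le_half {x : ℝ} (h1 : 1 ≤ x) : Real.exp (-x) ≤ 1 / 2 := by
  have := exp_neg_le_one_sub_half zero_le_one le_rfl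
  have h2 : Real.exp (-x) ≤ Real.exp (-1) := Real.exp_le_exp.2 (by linarith)
  linarith

namespace IsB1

variable {g : ℝ → ℝ}

/-- A quantitative weak law of large numbers by truncation: `L²` cancellation for the values up to
`n`, a crude `L¹` bound for the rest. -/
theorem integral_abs_average_sub_one_le (hg : IsB1 g) {n : ℕ} (hn : 0 < n) :
    ∫ w : Fin n → ℝ≥0, |(∑ i, (w i : ℝ)) / n - 1| ∂(Measure.pi fun _ => bernsteinMeasure g) ≤
      6 * √(1 + deriv g (1 / (n : ℝ))) := by
  have := hg.isProbabilityMeasure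
  set ν := bernsteinMeasure g with hν
  have hn' : (0 : ℝ) < n := by exact_mod_cast hn
  have hz : (0 : ℝ) < 1 / n := by positivity
  obtain ⟨hδi, hδ⟩ := hg.one_add_deriv_eq hz
  obtain ⟨hδ0, hδ1⟩ := hg.one_add_deriv_mem hz
  set δ := 1 + deriv g (1 / (n : ℝ)) with hδdef
  -- Level `n` matches the weight `s(1 - e^{-s/n})`, which is at least `s²/(2n)` for `s ≤ n` and at
  -- least `s/2` for `s > n`.
  let A : Set ℝ≥0 := {s | (s : ℝ) ≤ n}
  have hA : MeasurableSet A := measurableSet_le (by fun_prop) measurable_const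
  let Y : ℝ≥0 → ℝ := A.indicator fun s => (s : ℝ)
  let Z : ℝ≥0 → ℝ := Aᶜ.indicator fun s => (s : ℝ)
  have hYZ : ∀ s : ℝ≥0, (s : ℝ) = Y s + Z s := fun s => by
    have := indicator_self_add_compl_apply A (fun s : ℝ≥0 => (s : ℝ)) s
    exact this.symm
  have hYi : Integrable Y ν := hg.integrable_id.indicator hA
  have hZi : Integrable Z ν := hg.integrable_id.indicator hA.compl
  have hx : ∀ s : ℝ≥0, (0 : ℝ) ≤ 1 / n * s := fun s => by positivity
  have hw : ∀ s : ℝ≥0, 0 ≤ (s : ℝ) * (1 - Real.exp (-(1 / (n : ℝ) * s))) := fun s =>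
    mul_nonneg s.2 (sub_nonneg.2 (Real.exp_le_one_iff.2 (neg_nonpos.2 (hx s))))
  have hY2 : ∀ s, Y s ^ 2 ≤ 2 * n * ((s : ℝ) * (1 - Real.exp (-(1 / (n : ℝ) * s)))) := fun s => by
    by_cases hs : s ∈ A
    · have hs' : (s : ℝ) ≤ n := hs
      have h1 := exp_neg_le_one_sub_half (hx s) (by
        rw [one_div_mul_eq_div]; exact (div_le_one hn').2 hs')
      have h2 : (s : ℝ) * ((1 / n * s) / 2) ≤ (s : ℝ) * (1 - Real.exp (-(1 / (n : ℝ) * s))) :=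
        mul_le_mul_of_nonneg_left (by linarith) s.2
      have h3 := mul_le_mul_of_nonneg_left h2 (show (0 : ℝ) ≤ 2 * n by positivity)
      refine le_trans (le_of_eq ?_) h3
      simp only [Y, indicator_of_mem hs]
      field_simp
    · simp only [Y, indicator_of_notMem hs]
      have := mul_nonneg (show (0 : ℝ) ≤ 2 * n by positivity) (hw s)
      simpa using this
  have hZ2 : ∀ s, |Z s| ≤ 2 * ((s : ℝ) * (1 - Real.exp (-(1 / (n : ℝ) * s)))) := fun s => by
    by_cases hs : s ∈ A
    · simp only [Z, indicator_of_notMem (fun h : s ∈ Aᶜ => h hs), abs_zero]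
      exact mul_nonneg zero_le_two (hw s)
    · have hs' : (n : ℝ) < s := not_le.1 hs
      have h1 := exp_neg_le_half (x := 1 / n * s) (by
        rw [one_div_mul_eq_div]; exact (one_le_div hn').2 hs'.le)
      simp only [Z, indicator_of_mem (show s ∈ Aᶜ from hs), NNReal.abs_eq]
      have h2 : (s : ℝ) * (1 / 2) ≤ (s : ℝ) * (1 - Real.exp (-(1 / (n : ℝ) * s))) :=
        mul_le_mul_of_nonneg_left (by linarith) s.2
      linarith
  have hYm : MemLp Y 2 ν := by
    refine MemLp.of_bound hYi.1 n (ae_of_all _ fun s => ?_)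
    by_cases hs : s ∈ A
    · simp only [Y, indicator_of_mem hs, Real.norm_eq_abs, NNReal.abs_eq]
      exact hs
    · simp only [Y, indicator_of_notMem hs, norm_zero]
      exact hn'.le
  have hEY : (∫ s, Y s ^ 2 ∂ν) / n ≤ 2 * δ := by
    rw [div_le_iff₀ hn', hδ, mul_right_comm, ← integral_const_mul]
    exact integral_mono hYm.integrable_sq (hδi.const_mul _) hY2
  have hEZ : ∫ s, |Z s| ∂ν ≤ 2 * δ := by
    rw [hδ, ← integral_const_mul]
    exact integral_mono hZi.abs (hδi.const_mul _) hZ2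
  have hone : ∫ s, Y s ∂ν + ∫ s, Z s ∂ν = 1 := by
    rw [← integral_add hYi hZi, ← hg.integral_id]
    exact integral_congr_ae (ae_of_all _ fun s => (hYZ s).symm)
  have hpt : ∀ w : Fin n → ℝ≥0, |(∑ i, (w i : ℝ)) / n - 1| ≤
      |(∑ i, Y (w i)) / n - ∫ s, Y s ∂ν| + |(∑ i, Z (w i)) / n - ∫ s, Z s ∂ν| := fun w => by
    refine le_trans (le_of_eq ?_) (abs_add_le _ _)
    congr 1
    rw [← hone]
    simp only [hYZ (w _), Finset.sum_add_distrib]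
    ring
  have hmain := integral_mono (integrable_average (n := n) ν hg.integrable_id 1).abs
    ((integrable_average (n := n) ν hYi _).abs.add (integrable_average (n := n) ν hZi _).abs) hpt
  simp only [Pi.add_apply] at hmain
  rw [integral_add (integrable_average (n := n) ν hYi _).abs
    (integrable_average (n := n) ν hZi _).abs] at hmain
  have h1 := integral_abs_average_sub_le_sqrt ν hn hYm
  have h2 := integral_abs_average_sub_le ν hn hZi
  -- The bounded part contributes `2√δ` and the tail `2 · 2δ ≤ 4√δ`, since `δ ≤ 1`; together `6√δ`.
  have h3 : √((∫ s, Y s ^ 2 ∂ν) / n) ≤ 2 * √δ := by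
    refine (Real.sqrt_le_sqrt (hEY.trans (by linarith : 2 * δ ≤ 2 ^ 2 * δ))).trans (le_of_eq ?_)
    rw [Real.sqrt_mul (by norm_num), Real.sqrt_sq (by norm_num)]
  have h4 : δ ≤ √δ := by
    rw [Real.le_sqrt hδ0 hδ0]; nlinarith
  linarith

end IsB1

/-! ### Averages of orbits -/

theorem rpow_le_one_add {y α : ℝ} (hy : 0 ≤ y) (h0 : 0 ≤ α) (h1 : α ≤ 1) : y ^ α ≤ 1 + y := by
  rcases le_total y 1 with h | h
  · exact (Real.rpow_le_one hy h h0).trans (by linarith)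
  · exact (Real.rpow_le_rpow_of_exponent_le h h1).trans (by rw [Real.rpow_one]; linarith)

theorem integral_rpow_le_rpow_integral {Ω : Type*} [MeasurableSpace Ω] {π : Measure Ω}
    [IsProbabilityMeasure π] {h : Ω → ℝ} (hi : Integrable h π) (h0 : ∀ w, 0 ≤ h w) {α : ℝ}
    (hα : 0 ≤ α) (hα1 : α ≤ 1) :
    Integrable (fun w => h w ^ α) π ∧ ∫ w, h w ^ α ∂π ≤ (∫ w, h w ∂π) ^ α := by
  have hc : Integrable (fun w => h w ^ α) π := by
    refine ((integrable_const (1 : ℝ)).add hi).mono' (hi.1.aemeasurable.pow_const α).aestronglyMeasurable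
      (ae_of_all _ fun w => ?_)
    rw [Real.norm_of_nonneg (Real.rpow_nonneg (h0 w) α)]
    exact rpow_le_one_add (h0 w) hα hα1
  exact ⟨hc, (Real.concaveOn_rpow hα hα1).le_map_integral
    (fun x _ => (Real.continuousAt_rpow_const x α (Or.inr hα)).continuousWithinAt) isClosed_Ici
    (ae_of_all _ h0) hi hc⟩

namespace BoundedC0Semigroup

variable {X : Type*} [NormedAddCommGroup X] [NormedSpace ℂ X] [CompleteSpace X]

/-- Integrate the Hölder bound and apply Jensen to the concave power. Taking `α = 1` covers
`dom(A)`, so both cases of the theorem share this estimate. -/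
theorem norm_integral_orbit_sub_le (T : BoundedC0Semigroup X) {Ω : Type*} [MeasurableSpace Ω]
    {π : Measure Ω} [IsProbabilityMeasure π] {ξ : Ω → ℝ≥0} (hξ : Measurable ξ) (t : ℝ≥0) {x : X}
    {K α : ℝ} (hK0 : 0 ≤ K) (hα : 0 ≤ α) (hα1 : α ≤ 1)
    (hK : ∀ s t : ℝ≥0, ‖T.toFun s x - T.toFun t x‖ ≤ K * |(s : ℝ) - t| ^ α) {C : ℝ}
    (hi : Integrable (fun w => |(ξ w : ℝ) - t|) π) (hC : ∫ w, |(ξ w : ℝ) - t| ∂π ≤ C) :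
    ‖∫ w, T.toFun (ξ w) x ∂π - T.toFun t x‖ ≤ K * C ^ α := by
  have hT : Integrable (fun w => T.toFun (ξ w) x) π :=
    Integrable.of_bound ((T.continuous' x).comp_aestronglyMeasurable hξ.aestronglyMeasurable)
      (T.bound * ‖x‖) (ae_of_all _ fun w => T.norm_apply_le _ x)
  have e : ∫ w, T.toFun (ξ w) x ∂π - T.toFun t x = ∫ w, (T.toFun (ξ w) x - T.toFun t x) ∂π := by
    rw [integral_sub hT (integrable_const _)]
    simp
  obtain ⟨h1, h2⟩ := integral_rpow_le_rpow_integral hi (fun w => abs_nonneg _) hα hα1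
  rw [e]
  refine (norm_integral_le_of_norm_le (h1.const_mul K) (ae_of_all _ fun w => hK _ _)).trans ?_
  rw [integral_const_mul]
  refine mul_le_mul_of_nonneg_left (h2.trans (Real.rpow_le_rpow ?_ hC hα)) hK0
  exact integral_nonneg fun w => abs_nonneg _

variable {g : ℝ → ℝ}

theorem realCalc_deltaZero_apply (T : BoundedC0Semigroup X) (hg : IsB1 g) (x : X) :
    T.realCalc (deltaZero g) x = ∫ s, T.toFun s x ∂(bernsteinMeasure g) - T.toFun 1 x := by
  have := hg.isProbabilityMeasure
  rw [realCalc, (T.hpCalc_laplace_sub (bernsteinMeasure g) (Measure.dirac 1) fun z hz => ?_).2,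
    integral_dirac]
  rw [← hg.laplace_eq hz, laplace_dirac, deltaZero]
  simp

/-- Estimate of `Δ₀^g(A) x` for an orbit which is Hölder continuous. -/
theorem norm_realCalc_deltaZero_le (T : BoundedC0Semigroup X) (hg : IsB1 g) {x : X} {K α : ℝ}
    (hK0 : 0 ≤ K) (hα : 0 ≤ α) (hα1 : α ≤ 1)
    (hK : ∀ s t : ℝ≥0, ‖T.toFun s x - T.toFun t x‖ ≤ K * |(s : ℝ) - t| ^ α) :
    ‖T.realCalc (deltaZero g) x‖ ≤ K * (2 * functionalL g) ^ α := by
  have := hg.isProbabilityMeasure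
  rw [T.realCalc_deltaZero_apply hg]
  exact T.norm_integral_orbit_sub_le (ξ := fun s => s) measurable_id 1 hK0 hα hα1 hK
    (hg.integrable_id.sub (integrable_const 1)).abs hg.integral_abs_sub_one.le

/-- By independence the law of the sum of `n` coordinates has Laplace transform `g^n`. -/
theorem realCalc_scale_pow_apply (T : BoundedC0Semigroup X) (hg : IsB1 g) (n : ℕ) (r : ℝ≥0)
    (x : X) : (T.scale r).realCalc (fun z => g z ^ n) x =
      ∫ w : Fin n → ℝ≥0, T.toFun (r * ∑ i, w i) x ∂(Measure.pi fun _ => bernsteinMeasure g) := by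
  have := hg.isProbabilityMeasure
  have hm : Measurable fun w : Fin n → ℝ≥0 => ∑ i, w i := by fun_prop
  rw [realCalc, (T.scale r).hpCalc_laplace
    ((Measure.pi fun _ : Fin n => bernsteinMeasure g).map fun w => ∑ i, w i) x fun z hz => ?_,
    integral_map hm.aemeasurable ((T.scale r).continuous' x).aestronglyMeasurable]
  · rfl
  · congr 1
    rw [laplace, integral_map hm.aemeasurable (by fun_prop), hg.laplace_eq hz, laplace]
    have := (integral_fintype_prod_eq_pow (ι := Fin n) (μ := bernsteinMeasure g)
      (fun s : ℝ≥0 => Real.exp (-(z * s)))).symm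
    rw [Fintype.card_fin] at this
    rw [this]
    refine integral_congr_ae (ae_of_all _ fun w => ?_)
    simp only [← Real.exp_sum, NNReal.coe_sum, Finset.mul_sum, Finset.sum_neg_distrib]

/-- Estimate of `g^n(tA/n) x - e^{-tA} x` for an orbit which is Hölder continuous. -/
theorem norm_realCalc_scale_pow_sub_le (T : BoundedC0Semigroup X) (hg : IsB1 g) {n : ℕ}
    (hn : 0 < n) (t : ℝ≥0) {x : X} {K α : ℝ} (hK0 : 0 ≤ K) (hα : 0 ≤ α) (hα1 : α ≤ 1)
    (hK : ∀ s t : ℝ≥0, ‖T.toFun s x - T.toFun t x‖ ≤ K * |(s : ℝ) - t| ^ α) :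
    ‖(T.scale (t / n)).realCalc (fun z => g z ^ n) x - T.toFun t x‖ ≤
      K * (t * (6 * √(1 + deriv g (1 / (n : ℝ))))) ^ α := by
  have := hg.isProbabilityMeasure
  rw [T.realCalc_scale_pow_apply hg]
  have e : ∀ w : Fin n → ℝ≥0, |((t / n * ∑ i, w i : ℝ≥0) : ℝ) - t| =
      t * |(∑ i, (w i : ℝ)) / n - 1| := fun w => by
    conv_rhs => rw [← NNReal.abs_eq t, ← abs_mul]
    congr 1
    push_cast
    ring
  refine T.norm_integral_orbit_sub_le (by fun_prop) t hK0 hα hα1 hK ?_ ?_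
  · simp only [e]
    exact (integrable_average _ hg.integrable_id 1).abs.const_mul _
  · simp only [e]
    rw [integral_const_mul]
    exact mul_le_mul_of_nonneg_left (hg.integral_abs_average_sub_one_le hn) t.2

end BoundedC0Semigroup

end

/-! ### Comparison of constants and the final estimates -/

theorem six_le_four_mul_exp_mul {y : ℝ} (hy : 0 ≤ y) : 6 ≤ 4 * Real.exp 1 * (1 + 1 / y) := by
  -- Already `4e ≥ 8`, so the factor `1 + 1/y` is only needed to be at least `1`; this includes `y =
  -- 0`, where `1 / y = 0`.
  have h1 := Real.add_one_le_exp (1 : ℝ)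
  have h2 : 0 ≤ 1 / y := by positivity
  nlinarith

theorem mainTheorem2 {X : Type*} [NormedAddCommGroup X] [NormedSpace ℂ X] [CompleteSpace X]
    (T : BoundedC0Semigroup X) (g : ℝ → ℝ) (hg : IsB1 g) :
    ((∀ x : T.negGenerator.domain,
        ‖T.realCalc (deltaZero g) (x : X)‖ ≤ 2 * T.bound * functionalL g * ‖T.negGenerator x‖) ∧
      ∀ α : ℝ, 0 < α → α < 1 → ∀ x : (T.fracPow α).domain,
        ‖T.realCalc (deltaZero g) (x : X)‖ ≤
          8 * T.bound * functionalL g ^ α * ‖T.fracPow α x‖) ∧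
    ∀ n : ℕ, 1 ≤ n → ∀ t : ℝ≥0, 0 < t →
      (∀ x : T.negGenerator.domain,
        ‖(T.scale (t / n)).realCalc (fun z => g z ^ n) (x : X) - T.toFun t (x : X)‖ ≤
          4 * Real.exp 1 * T.bound * (1 + 1 / |deriv g (1 / (n : ℝ))|) *
            √(1 + deriv g (1 / (n : ℝ))) * (t : ℝ) * ‖T.negGenerator x‖) ∧
      ∀ α : ℝ, 0 < α → α < 1 → ∀ x : (T.fracPow α).domain,
        ‖(T.scale (t / n)).realCalc (fun z => g z ^ n) (x : X) - T.toFun t (x : X)‖ ≤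
          16 * Real.exp 1 * T.bound * (1 + 1 / |deriv g (1 / (n : ℝ))|) *
            (1 + deriv g (1 / (n : ℝ))) ^ (α / 2) * (t : ℝ) ^ α * ‖T.fracPow α x‖ := by
  have hM := T.bound_nonneg
  have hL := functionalL_nonneg g
  have hA : ∀ x : T.negGenerator.domain, ∀ s t : ℝ≥0, ‖T.toFun s x - T.toFun t x‖ ≤
      T.bound * ‖T.negGenerator x‖ * |(s : ℝ) - t| ^ (1 : ℝ) := fun x s t => by
    rw [Real.rpow_one]
    exact T.norm_orbit_sub_le x s t
  refine ⟨⟨fun x => ?_, fun α h0 h1 x => ?_⟩, fun n hn t ht => ?_⟩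
  · refine (T.norm_realCalc_deltaZero_le hg (by positivity) zero_le_one le_rfl (hA x)).trans
      (le_of_eq ?_)
    rw [Real.rpow_one]
    ring
  · refine (T.norm_realCalc_deltaZero_le hg (by positivity) h0.le h1.le
      (T.norm_orbit_sub_le_fracPow h0 h1 x)).trans ?_
    rw [Real.mul_rpow zero_le_two hL]
    have h2 : (2 : ℝ) ^ α ≤ 2 := by
      simpa using Real.rpow_le_rpow_of_exponent_le one_le_two h1.le
    have h3 : 0 ≤ 4 * T.bound * ‖T.fracPow α x‖ * functionalL g ^ α := by positivity
    have := mul_le_mul_of_nonneg_left h2 h3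
    linarith
  · obtain ⟨hδ, -⟩ := hg.one_add_deriv_mem (z := 1 / (n : ℝ))
      (by have : (0 : ℝ) < n := by exact_mod_cast hn
          positivity)
    have hE := six_le_four_mul_exp_mul (abs_nonneg (deriv g (1 / (n : ℝ))))
    set δ := 1 + deriv g (1 / (n : ℝ)) with hδdef
    set E := 1 + 1 / |deriv g (1 / (n : ℝ))|
    refine ⟨fun x => ?_, fun α h0 h1 x => ?_⟩
    · refine (T.norm_realCalc_scale_pow_sub_le hg hn t (by positivity) zero_le_one le_rfl
        (hA x)).trans ?_
      rw [Real.rpow_one]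
      have h3 : 0 ≤ T.bound * ‖T.negGenerator x‖ * t * √δ := by positivity
      have := mul_le_mul_of_nonneg_right hE h3
      linarith
    · refine (T.norm_realCalc_scale_pow_sub_le hg hn t (by positivity) h0.le h1.le
        (T.norm_orbit_sub_le_fracPow h0 h1 x)).trans ?_
      have hsq : √δ ^ α = δ ^ (α / 2) := by
        rw [Real.sqrt_eq_rpow, ← Real.rpow_mul hδ]
        ring_nf
      rw [← hδdef, Real.mul_rpow (NNReal.coe_nonneg t) (by positivity),
        Real.mul_rpow (by norm_num) (Real.sqrt_nonneg _), hsq]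
      -- The Hölder constant `4M` times `6^α ≤ 6 ≤ 4e(1 + 1/|g'(1/n)|)` yields the factor `16e`.
      have h2 : (6 : ℝ) ^ α ≤ 6 := by
        simpa using Real.rpow_le_rpow_of_exponent_le (by norm_num : (1 : ℝ) ≤ 6) h1.le
      have h3 : 0 ≤ 4 * T.bound * ‖T.fracPow α x‖ * (t : ℝ) ^ α * δ ^ (α / 2) := by positivity
      have := mul_le_mul_of_nonneg_right (h2.trans hE) h3
      linarith
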